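/- **Setting.** Let $\mathcal X$ be a finite alphabet, $\mu_0,\mu_1$ probability distributions on $\mathcal X$, $n_0\ge 1$, $\lambda\in\mathbb R$, and let all logarithms be to base $2$, with $\log 0=-\infty$. Let $L$ be the length function of a family of one-to-one binary codes $\varphi_n:\mathcal X^n\to\{0,1\}^*$ with prefix-free images. For samples $x_1,x_2,\dots$ let $\hat\mu_0(a)=N(a\mid x_1^{n_0})/n_0$ be the empirical distribution of $x_1^{n_0}$, and write $\nu(w)=\prod_i\nu(w_i)$ for a distribution $\nu$ and a word $w$. For $\gamma>1$ the stopping time of Test 3 is $$M(\gamma)=\inf\Big\{n\ge 1:\ \max_{1\le k\le n}\big(-L(x_{n_0+k}^{n_0+n})-\log\hat\mu_0(x_{n_0+k}^{n_0+n})-(n-k+1)\lambda\big)\ge\log\gamma\Big\}\in\{1,2,\dots\}\cup\{\infty\}.$$ Put $Y_i=x_{n_0+i}$. Under $P_0$ all samples are i.i.d. with law $\mu_0$; under $P_m$, $m\ge1$, all samples are independent, $x_1,\dots,x_{n_0}$ and $Y_i$, $i<m$, have law $\mu_0$, and $Y_i$, $i\ge m$, have law $\mu_1$. Let $E_m$ be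 the expectation under $P_m$, and $$\bar E_1(M\mid x_1^{n_0})=\sup_{m\ge1}\operatorname{ess\,sup}E_m\big[(M-m+1)^+\mid x_1^{n_0},Y_1,\dots,Y_{m-1}\big],$$ where the essential supremum is over $Y_1,\dots,Y_{m-1}$, given $x_1^{n_0}$. Let $D(\mu\|\nu)=\sum_a\mu(a)\log\frac{\mu(a)}{\nu(a)}\in[0,\infty]$. **Theorem.** 1. Let $a$ be a symbol of minimum probability among those with $\mu_0(a)>0$, let $0<\delta<\mu_0(a)$, $\beta=\mu_0(a)/(\mu_0(a)-\delta)$, and let $\varepsilon_0$ satisfy $P_0\big(\exists\, b\in\mathcal X:\ |\hat\mu_0(b)-\mu_0(b)|>\delta\big)\le\varepsilon_0$. If $\lambda>\log\beta$, then for every $\gamma>1$ $$E_0(M(\gamma))\ \ge\ \frac{\gamma}{\dfrac{1}{2^{\lambda-\log\beta}-1}+\varepsilon_0\gamma}.$$ 2. Suppose that the code is strongly universal for a class $\mathcal M$ of memoryless sources with $\mu_1\in\mathcal M$, that is, $\sup_{\mu\in\mathcal M}\max_{w\in\mathcal X^n}(L(w)+\log\mu(w))=o(n)$. Then for every $x_1^{n_0}$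 with $\mu_0(x_1^{n_0})>0$ and $\lambda<D(\mu_1\|\hat\mu_0)$, as $\gamma\to\infty$, $$\bar E_1(M(\gamma)\mid x_1^{n_0})\ \sim\ \frac{|\log\gamma|}{D(\mu_1\|\hat\mu_0)-\lambda},$$ which, in the case $D(\mu_1\|\hat\mu_0)=\infty$, means $\bar E_1(M(\gamma)\mid x_1^{n_0})/|\log\gamma|\to0$. -/

import Mathlib

open MeasureTheory ProbabilityTheory Filter Topology
open scoped ENNReal

noncomputable section

namespace SeqChange

/-- A family of fixed-to-variable length binary codes, one for each block length: every block
code is one-to-one, and its set of codewords is prefix-free. -/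
structure PrefixCode (X : Type*) where
  encode : (n : ℕ) → (Fin n → X) → List Bool
  injective : ∀ n, Function.Injective (encode n)
  prefixFree : ∀ n, ∀ u ∈ Set.range (encode n), ∀ v ∈ Set.range (encode n), u <+: v → u = v

/-- The length function of a code. -/
def PrefixCode.len {X : Type*} (C : PrefixCode X) {n : ℕ} (w : Fin n → X) : ℕ :=
  (C.encode n w).length

/-- Logarithm to base `2` on `[0, ∞]`, with `log 0 = -∞`. -/
def log2 (p : ℝ≥0∞) : EReal := ENNReal.log p / (Real.log 2 : ℝ)

/-- Probability of a word when the letters are independent with probabilities `ν`. -/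
def wordProb {X : Type*} (ν : X → ℝ≥0∞) {n : ℕ} (w : Fin n → X) : ℝ≥0∞ := ∏ i, ν (w i)

/-- Worst-case redundancy at block length `n` of a code over a class `S` of memoryless sources:
`sup_{μ ∈ S} max_w (L(w) + log μ(w))`. -/
def redundancy {X : Type*} (C : PrefixCode X) (S : Set (PMF X)) (n : ℕ) : EReal :=
  ⨆ μ ∈ S, ⨆ w : Fin n → X, (((C.len w : ℝ) : EReal) + log2 (wordProb μ w))

/-- The code is strongly universal for the class `S`: its worst-case redundancy is `o(n)`. -/
def IsStronglyUniversal {X : Type*} (C : PrefixCode X) (S : Set (PMF X)) : Prop :=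
  Tendsto (fun n : ℕ => redundancy C S n / ((n : ℝ) : EReal)) atTop (𝓝 0)

/-- Kullback-Leibler divergence in bits, `∑ μ(a) log (μ(a) / ν(a))`. A letter with `μ(a) = 0`
contributes `0`; a letter with `μ(a) > 0 = ν(a)` makes the sum `+∞`. -/
def klBits {X : Type*} [Fintype X] (μ ν : X → ℝ≥0∞) : EReal :=
  ∑ a, ((μ a : ℝ≥0∞) : EReal) * log2 (μ a / ν a)

/-- Relative frequencies of the letters in the word `x`. -/
def empirical {X : Type*} [DecidableEq X] {n : ℕ} (x : Fin n → X) (a : X) : ℝ≥0∞ :=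
  ((Finset.univ.filter fun i => x i = a).card : ℝ≥0∞) / n

/-- The block of length `l` of the sequence `ω` that starts at (zero-based) position `s`. -/
def block {X : Type*} (ω : ℕ → X) (s l : ℕ) : Fin l → X := fun i => ω (s + i)

/-- The score `-L(w) - log ν(w) - l λ` of a word `w` of length `l`. -/
def score {X : Type*} (C : PrefixCode X) (ν : X → ℝ≥0∞) (lam : ℝ) {l : ℕ} (w : Fin l → X) :
    EReal :=
  -((C.len w : ℝ) : EReal) - log2 (wordProb ν w) - ((l * lam : ℝ) : EReal)

/-- The test statistic after `n` observations beyond the first `n₀`: the maximum over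
`1 ≤ k ≤ n` of the score of `x_{n₀+k}, …, x_{n₀+n}`, computed with the empirical distribution of
`x_1, …, x_{n₀}`. The sample `x_j` is `ω (j - 1)`. -/
def statistic {X : Type*} [DecidableEq X] (C : PrefixCode X) (lam : ℝ) (n₀ : ℕ) (ω : ℕ → X)
    (n : ℕ) : EReal :=
  (Finset.Icc 1 n).sup fun k =>
    score C (empirical (block ω 0 n₀)) lam (block ω (n₀ + k - 1) (n - k + 1))

/-- The stopping time `M(γ)`: the first `n ≥ 1` at which the statistic is at least `log γ`
(`∞` if there is none). -/
def stopTime {X : Type*} [DecidableEq X] (C : PrefixCode X) (lam : ℝ) (n₀ : ℕ) (γ : ℝ)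
    (ω : ℕ → X) : ℕ∞ :=
  ⨅ (n : ℕ) (_ : 1 ≤ n ∧ ((Real.logb 2 γ : ℝ) : EReal) ≤ statistic C lam n₀ ω n), (n : ℕ∞)

/-- Law of the whole sequence of samples when there is no change: i.i.d. with law `μ₀`. -/
def noChange {X : Type*} [MeasurableSpace X] (μ₀ : PMF X) : Measure (ℕ → X) :=
  Measure.infinitePi fun _ => μ₀.toMeasure

/-- Law of the whole sequence of independent samples when, with `Y_i = x_{n₀+i}`, the change
point is `m ≥ 1`: `x_1, …, x_{n₀}` and `Y_i`, `i < m`, have law `μ₀`, and `Y_i`, `i ≥ m`, have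
law `μ₁`. -/
def changeAt {X : Type*} [MeasurableSpace X] (μ₀ μ₁ : PMF X) (n₀ m : ℕ) : Measure (ℕ → X) :=
  Measure.infinitePi fun j => (if j < n₀ + m - 1 then μ₀ else μ₁).toMeasure

/-- The σ-algebra generated by the first `t` samples. -/
abbrev firstSamples (X : Type*) [MeasurableSpace X] (t : ℕ) : MeasurableSpace (ℕ → X) :=
  MeasurableSpace.comap (fun ω => block ω 0 t) inferInstance

/-- Lorden's worst-case mean delay of `T`, conditionally on the first `n₀` samples `x`:
`sup_{m ≥ 1} ess sup E_m[(T - m + 1)⁺ | x_1, …, x_{n₀}, Y_1, …, Y_{m-1}]`, where the essential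
supremum is taken under the law conditioned on the event that the first `n₀` samples are `x`.
Subtraction in `[0, ∞]` is truncated at `0`. -/
def worstDelay {X : Type*} [MeasurableSpace X] (μ₀ μ₁ : PMF X) {n₀ : ℕ} (T : (ℕ → X) → ℕ∞)
    (x : Fin n₀ → X) : ℝ≥0∞ :=
  ⨆ (m : ℕ) (_ : 1 ≤ m),
    essSup
      (condLExp (firstSamples X (n₀ + m - 1)) (changeAt μ₀ μ₁ n₀ m)
        fun ω => (T ω : ℝ≥0∞) + 1 - m)
      ((changeAt μ₀ μ₁ n₀ m)[|{ω | block ω 0 n₀ = x}])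

end SeqChange

end

/-!
The test compares the universal code with the ideal code for the empirical distribution
`ν = μ̂₀` of the first `n₀` samples, and it stops as soon as some block of the later samples has
score at least `log γ`. Since the later samples are independent of the first ones, everything
can be computed for a fixed `ν` and an i.i.d. sequence (`setLIntegral_block_shift`).

*False alarms.* If all letter frequencies are within `δ` of `μ₀`, then `μ₀ ≤ β ν`, and a word of
length `l` and score at least `log γ` has
`μ₀(w) ≤ γ⁻¹ 2 ^ (-l (λ - log β)) 2 ^ (-L(w))`. Kraft's inequality and a geometric series
bound the probability that some initial word has such a score by
`q = γ⁻¹ / (2 ^ (λ - log β) - 1)` (`noChange_exists_highScore_le`). A renewal argument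
(`one_le_mul_lintegral_firstTime`) turns this into a mean time to the first alarm of at least
`1 / q`: every alarm restarts the test afresh, so in the long run at least one in every `E T`
starting positions begins a word of high score. Averaging over the first `n₀` samples gives the
bound `1 / (q + ε₀)`.

*Delay.* Conditionally on the past, a change at time `m` is followed by an i.i.d. sequence with
law `μ₁`. Hence the worst-case delay lies between the mean time `T` at which some block of such a
sequence ends with a high score (a change at time `1`) and the mean time `N` at which the whole
sequence observed so far has a high score (`le_worstDelay_stopTime`, `worstDelay_stopTime_le`).
The score of a word of length `l` is its log-likelihood ratio of `μ₁` to `ν`, with mean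
`l D(μ₁ ‖ ν)`, minus `l λ` and minus the redundancy `L(w) + log μ₁(w)` of the code.

* Strong universality makes the redundancy `o(l)`, so by Hoeffding's inequality the score of the
  first `n` letters is below `log γ` with exponentially small probability once
  `n > log γ / d`, where `d < D(μ₁ ‖ ν) - λ`; summing the tails,
  `E N ≤ log γ / d + O(1)` (`exists_lintegral_firstHighScore_le`).
* By Kraft's inequality the redundancy is rarely below `-ε log γ`, whatever the code. With
  Hoeffding's inequality, a union bound over the `O(log² γ)` blocks up to time
  `(1 - 2 ε) log γ / (D(μ₁ ‖ ν) - λ)` shows that an alarm by that time is improbable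
  (`exists_le_lintegral_firstTime_highScore`).

If `D(μ₁ ‖ ν) = ∞`, some letter with `μ₁(b) > 0 = ν(b)` raises the score to `∞`, and the delay is
at most the mean waiting time for it, whatever `γ`.
-/

namespace SeqChange

/-! ### First occurrence times -/

section Samples

/-- The first `n` at which `p` holds, `∞` if there is none. -/
noncomputable def firstTime (p : ℕ → Prop) : ℕ∞ := ⨅ (n : ℕ) (_ : p n), (n : ℕ∞)

theorem firstTime_le_iff {p : ℕ → Prop} {n : ℕ} : firstTime p ≤ n ↔ ∃ k ≤ n, p k := by
  constructor
  · intro h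
    by_contra! hn
    have : ((n + 1 : ℕ) : ℕ∞) ≤ firstTime p :=
      le_iInf₂ fun k hk => by
        have : n < k := by
          by_contra! hkn
          exact hn k hkn hk
        exact_mod_cast this
    have := this.trans h
    norm_cast at this
    omega
  · rintro ⟨k, hk, hp⟩
    exact (iInf₂_le k hp).trans (by exact_mod_cast hk)

theorem lt_firstTime_iff {p : ℕ → Prop} {n : ℕ} : (n : ℕ∞) < firstTime p ↔ ∀ k ≤ n, ¬ p k := by
  rw [← not_le, firstTime_le_iff]
  push Not
  rfl

/-- If `q` holds at `c + n` whenever `p` holds at `n`, then `q` first holds at most `c` later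
than `p`. -/
theorem firstTime_add_le {p q : ℕ → Prop} {c : ℕ} (h : ∀ n, p n → q (c + n)) :
    firstTime q ≤ c + firstTime p := by
  by_cases hp : ∃ n, p n
  · obtain ⟨n, hn⟩ : ∃ n : ℕ, firstTime p = n := by
      obtain ⟨n, hn⟩ := hp
      exact ⟨_, (ENat.natCast_toNat (ne_top_of_le_ne_top (ENat.natCast_ne_top n)
        (firstTime_le_iff.2 ⟨n, le_rfl, hn⟩))).symm⟩
    obtain ⟨k, hk, hpk⟩ := firstTime_le_iff.1 hn.le
    rw [hn]
    exact_mod_cast firstTime_le_iff.2 ⟨c + k, by omega, h k hpk⟩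
  · have : firstTime p = ⊤ := by
      simp only [firstTime, iInf_eq_top]
      exact fun n hn => absurd ⟨n, hn⟩ hp
    simp [this]

open Classical in
/-- Tail-sum formula: a first occurrence time counts the `n` it exceeds. -/
theorem firstTime_eq_tsum (p : ℕ → Prop) :
    (firstTime p : ℝ≥0∞) = ∑' n : ℕ, if ∀ k ≤ n, ¬ p k then 1 else 0 := by
  simp_rw [← lt_firstTime_iff]
  induction firstTime p using ENat.recTopCoe with
  | top => simp
  | coe N =>
    rw [tsum_eq_sum (s := Finset.range N)]
    · rw [Finset.sum_congr rfl (g := fun _ => 1)]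
      · simp
      · intro n hn
        have : n < N := by simpa using hn
        simp [this]
    · intro n hn
      have : ¬ n < N := by simpa using hn
      simp [this]

theorem measurable_firstTime {Ω : Type*} [MeasurableSpace Ω] {p : Ω → ℕ → Prop}
    (hp : ∀ n, MeasurableSet {ω | p ω n}) : Measurable fun ω => (firstTime (p ω) : ℝ≥0∞) := by
  classical
  simp_rw [firstTime_eq_tsum]
  refine Measurable.tsum fun n => Measurable.ite ?_ measurable_const measurable_const
  simp only [Set.ofPred_forall]
  exact MeasurableSet.iInter fun k => MeasurableSet.iInter fun _ => (hp k).compl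

theorem lintegral_firstTime {Ω : Type*} [MeasurableSpace Ω] (P : Measure Ω) {p : Ω → ℕ → Prop}
    (hp : ∀ n, MeasurableSet {ω | p ω n}) :
    ∫⁻ ω, (firstTime (p ω) : ℝ≥0∞) ∂P = ∑' n : ℕ, P {ω | ∀ k ≤ n, ¬ p ω k} := by
  classical
  have hm : ∀ n : ℕ, MeasurableSet {ω | ∀ k ≤ n, ¬ p ω k} := fun n => by
    simp only [Set.ofPred_forall]
    exact MeasurableSet.iInter fun k => MeasurableSet.iInter fun _ => (hp k).compl
  simp_rw [firstTime_eq_tsum]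
  rw [lintegral_tsum fun n =>
    (Measurable.ite (hm n) measurable_const measurable_const).aemeasurable]
  refine tsum_congr fun n => ?_
  rw [← lintegral_indicator_one (hm n)]
  refine lintegral_congr fun ω => ?_
  simp [Set.indicator_apply]

/-! ### Blocks of independent samples -/

variable {X : Type*}

/-- The sequence of samples from (zero-based) position `t` on. -/
def shift (t : ℕ) (ω : ℕ → X) : ℕ → X := fun i => ω (t + i)

theorem block_shift (t s l : ℕ) (ω : ℕ → X) : block (shift t ω) s l = block ω (t + s) l := by
  funext i
  simp [block, shift, add_assoc]

section Measure

variable [MeasurableSpace X]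

theorem measurable_shift (t : ℕ) : Measurable (shift (X := X) t) := by
  unfold shift; fun_prop

theorem measurable_block (s l : ℕ) : Measurable fun ω : ℕ → X => block ω s l := by
  unfold block; fun_prop

/-- Deleting the first samples of an independent sequence. -/
theorem map_shift_infinitePi (ν : ℕ → Measure X) [∀ i, IsProbabilityMeasure (ν i)] (t : ℕ) :
    (Measure.infinitePi ν).map (shift t) = Measure.infinitePi fun i => ν (t + i) :=
  Measure.map_infinitePi_infinitePi_of_inj (f := fun i => t + i) (add_right_injective t)

/-- The first `t` samples are independent of the later ones. -/
theorem indepFun_block_shift (ν : ℕ → Measure X) [∀ i, IsProbabilityMeasure (ν i)] (t : ℕ) :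
    IndepFun (fun ω : ℕ → X => block ω 0 t) (shift t) (Measure.infinitePi ν) := by
  have h : iIndepFun (fun (i : ℕ) (ω : ℕ → X) => ω i) (Measure.infinitePi ν) :=
    iIndepFun_infinitePi (X := fun _ x => x) (by fun_prop)
  have h2 := indep_iSup_of_disjoint (fun i => (measurable_pi_apply i).comap_le) h
    (S := {i | i < t}) (T := {i | t ≤ i})
    (Set.disjoint_left.2 fun i (h1 : i < t) (h2 : t ≤ i) => by omega)
  rw [IndepFun_iff_Indep]
  refine indep_of_indep_of_le_left (indep_of_indep_of_le_right h2 ?_) ?_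
  · rw [MeasurableSpace.pi, MeasurableSpace.comap_iSup]
    refine iSup_le fun i => ?_
    rw [MeasurableSpace.comap_comp]
    exact le_iSup₂_of_le (t + i) (by simp) le_rfl
  · rw [MeasurableSpace.pi, MeasurableSpace.comap_iSup]
    refine iSup_le fun i => ?_
    rw [MeasurableSpace.comap_comp]
    exact le_iSup₂_of_le (0 + (i : ℕ)) (by simp) le_rfl

/-- The probability of an initial word. -/
theorem infinitePi_block_eq [MeasurableSingletonClass X] (ν : ℕ → Measure X)
    [∀ i, IsProbabilityMeasure (ν i)] {t : ℕ}
    (y : Fin t → X) :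
    Measure.infinitePi ν {ω | block ω 0 t = y} = ∏ i : Fin t, ν i {y i} := by
  have : Measure.infinitePi ν {ω | block ω 0 t = y} =
      (Measure.infinitePi ν).map (fun ω (i : Fin t) => ω i) {y} := by
    rw [Measure.map_apply (by fun_prop) (measurableSet_singleton y)]
    congr 1
    ext ω
    simp [block, funext_iff]
  rw [this, Measure.map_infinitePi_infinitePi_of_inj (f := fun i : Fin t => (i : ℕ))
    Fin.val_injective, Measure.infinitePi_eq_pi, Measure.pi_singleton]

theorem noChange_block_eq [MeasurableSingletonClass X] (μ : PMF X) {l : ℕ} (w : Fin l → X) :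
    noChange μ {ω | block ω 0 l = w} = wordProb μ w := by
  rw [noChange, infinitePi_block_eq]
  exact Finset.prod_congr rfl fun i _ => μ.toMeasure_apply_singleton _ (measurableSet_singleton _)

instance isProbabilityMeasure_noChange (μ : PMF X) : IsProbabilityMeasure (noChange μ) := by
  unfold noChange; infer_instance

theorem noChange_shift (μ : PMF X) (t : ℕ) {E : Set (ℕ → X)} (hE : MeasurableSet E) :
    noChange μ {ω | shift t ω ∈ E} = noChange μ E := by
  have := map_shift_infinitePi (fun _ => μ.toMeasure) t
  conv_rhs => rw [noChange, ← this]
  rw [Measure.map_apply (measurable_shift t) hE]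
  rfl

variable [Finite X] [MeasurableSingletonClass X]

theorem measurableSet_block (s l : ℕ) (B : Set (Fin l → X)) :
    MeasurableSet {ω : ℕ → X | block ω s l ∈ B} :=
  measurable_block s l B.toFinite.measurableSet

/-- An integral factors if one factor is a function of the first `t` samples and the other
one of the later samples. -/
theorem lintegral_mul_shift (ν : ℕ → Measure X) [∀ i, IsProbabilityMeasure (ν i)] {t : ℕ}
    {g F : (ℕ → X) → ℝ≥0∞} (hg : g.FactorsThrough fun ω => block ω 0 t) (hF : Measurable F) :
    ∫⁻ ω, g ω * F (shift t ω) ∂Measure.infinitePi ν =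
      (∫⁻ ω, g ω ∂Measure.infinitePi ν) *
        ∫⁻ ω, F ω ∂Measure.infinitePi fun i => ν (t + i) := by
  obtain ⟨G, rfl⟩ := (Function.factorsThrough_iff g).1 hg
  have hG : Measurable G := measurable_of_finite G
  have := lintegral_mul_eq_lintegral_mul_lintegral_of_indepFun
    (hG.comp (measurable_block 0 t)) (hF.comp (measurable_shift t))
    ((indepFun_block_shift ν t).comp hG hF)
  rw [← map_shift_infinitePi ν t, lintegral_map hF (measurable_shift t)]
  simpa using this

/-- The part of an integral over the event that the first `t` samples are `y`. -/
theorem setLIntegral_block_shift (ν : ℕ → Measure X) [∀ i, IsProbabilityMeasure (ν i)] {t : ℕ}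
    (y : Fin t → X) {F : (ℕ → X) → ℝ≥0∞} (hF : Measurable F) :
    ∫⁻ ω in {ω | block ω 0 t = y}, F (shift t ω) ∂Measure.infinitePi ν =
      Measure.infinitePi ν {ω | block ω 0 t = y} *
        ∫⁻ ω, F ω ∂Measure.infinitePi fun i => ν (t + i) := by
  have hm : MeasurableSet {ω : ℕ → X | block ω 0 t = y} := measurableSet_block 0 t {y}
  rw [← lintegral_indicator hm, ← lintegral_indicator_one hm, ← lintegral_mul_shift ν _ hF]
  · refine lintegral_congr fun ω => ?_
    by_cases h : block ω 0 t = y <;> simp [Set.indicator, h]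
  · intro ω ω' h
    have h : block ω 0 t = block ω' 0 t := h
    by_cases h' : block ω' 0 t = y <;> simp [Set.indicator, h.trans, h']

theorem noChange_block_mem_shift (μ : PMF X) (s l : ℕ) (B : Set (Fin l → X)) :
    noChange μ {ω | block ω s l ∈ B} = noChange μ {ω | block ω 0 l ∈ B} := by
  rw [← noChange_shift μ s (measurableSet_block 0 l B)]
  simp [block_shift]

end Measure

open Classical in
theorem noChange_block_mem [Fintype X] [MeasurableSpace X] [MeasurableSingletonClass X]
    (μ : PMF X) {l : ℕ} (B : Set (Fin l → X)) :
    noChange μ {ω | block ω 0 l ∈ B} = ∑ w with w ∈ B, wordProb μ w := by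
  simp_rw [← noChange_block_eq]
  rw [← measure_biUnion_finset]
  · congr 1
    ext ω
    simp
  · intro w _ w' _ hne
    exact Set.disjoint_left.2 fun ω (h : block ω 0 l = w) (h' : block ω 0 l = w') =>
      hne (h.symm.trans h')
  · intro w _
    exact measurableSet_block 0 l {w}

end Samples

/-! ### Kraft's inequality -/

section FalseAlarm

variable {X : Type*}

/-- A prefix-free set of nonempty words is uniquely decodable. -/
theorem uniquelyDecodable_of_prefixFree {S : Set (List Bool)}
    (hS : ∀ u ∈ S, ∀ v ∈ S, u <+: v → u = v) (hnil : [] ∉ S) :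
    InformationTheory.UniquelyDecodable S := by
  intro L₁
  induction L₁ with
  | nil =>
    intro L₂ _ h₂ h
    cases L₂ with
    | nil => rfl
    | cons v L₂ =>
      have : v = [] := by
        have h : v = [] ∧ L₂.flatten = [] := by simpa using h
        exact h.1
      exact absurd (this ▸ h₂ v (by simp)) hnil
  | cons u L₁ ih =>
    intro L₂ h₁ h₂ h
    cases L₂ with
    | nil =>
      have : u = [] := by
        have h : u = [] ∧ L₁.flatten = [] := by simpa using h
        exact h.1
      exact absurd (this ▸ h₁ u (by simp)) hnil
    | cons v L₂ =>
      simp only [List.flatten_cons] at h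
      have huv : u = v := by
        have hu : u <+: v ++ L₂.flatten := h ▸ List.prefix_append _ _
        rcases List.prefix_or_prefix_of_prefix hu (List.prefix_append _ _) with h' | h'
        · exact hS u (h₁ u (by simp)) v (h₂ v (by simp)) h'
        · exact (hS v (h₂ v (by simp)) u (h₁ u (by simp)) h').symm
      subst huv
      rw [ih L₂ (fun w hw => h₁ w (by simp [hw])) (fun w hw => h₂ w (by simp [hw]))
        (List.append_cancel_left h)]

theorem PrefixCode.sum_two_pow_neg_len_le_one [Fintype X] (C : PrefixCode X) (l : ℕ) :
    ∑ w : Fin l → X, (1 / 2 : ℝ) ^ C.len w ≤ 1 := by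
  classical
  by_cases hnil : ∃ w, C.encode l w = []
  · obtain ⟨w, hw⟩ := hnil
    have huniv : (Finset.univ : Finset (Fin l → X)) = {w} := by
      ext w'
      simp only [Finset.mem_univ, Finset.mem_singleton, true_iff]
      refine (C.injective l (C.prefixFree l _ ⟨w, rfl⟩ _ ⟨w', rfl⟩ ?_)).symm
      simp [hw]
    simp [huniv, PrefixCode.len, hw]
  · have hS : InformationTheory.UniquelyDecodable
        ((Finset.univ.image (C.encode l) : Finset (List Bool)) : Set (List Bool)) := by
      have : ((Finset.univ.image (C.encode l) : Finset (List Bool)) : Set (List Bool)) =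
        Set.range (C.encode l) := by simp
      rw [this]
      exact uniquelyDecodable_of_prefixFree (C.prefixFree l) (by simpa using hnil)
    have h := InformationTheory.kraft_mcmillan_inequality hS
    rw [Finset.sum_image fun a _ b _ hab => C.injective l hab] at h
    simpa [PrefixCode.len] using h

/-- Kraft's inequality bounds the probability of the words that are at most `c 2 ^ (-L)`
likely. -/
theorem noChange_block_mem_le_of_kraft [Fintype X] [MeasurableSpace X]
    [MeasurableSingletonClass X] (C : PrefixCode X) (μ : PMF X) {l : ℕ} {B : Set (Fin l → X)}
    {c : ℝ} (hc : 0 ≤ c)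
    (hB : ∀ w ∈ B, wordProb μ w ≠ 0 →
      (wordProb μ w).toReal ≤ c * (1 / 2 : ℝ) ^ C.len w) :
    noChange μ {ω | block ω 0 l ∈ B} ≤ ENNReal.ofReal c := by
  classical
  have hfin : ∀ w : Fin l → X, wordProb μ w ≠ ⊤ := fun w =>
    ENNReal.prod_ne_top fun i _ => μ.apply_ne_top _
  rw [noChange_block_mem]
  calc ∑ w with w ∈ B, wordProb μ w
      ≤ ∑ w : Fin l → X, ENNReal.ofReal (c * (1 / 2 : ℝ) ^ C.len w) := by
        refine (Finset.sum_le_sum fun w hw => ?_).trans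
          (Finset.sum_le_sum_of_subset (Finset.subset_univ _))
        by_cases h0 : wordProb μ w = 0
        · simp [h0]
        · rw [← ENNReal.ofReal_toReal (hfin w)]
          exact ENNReal.ofReal_le_ofReal (hB w (by simpa using hw) h0)
    _ = ENNReal.ofReal (∑ w : Fin l → X, c * (1 / 2 : ℝ) ^ C.len w) :=
        (ENNReal.ofReal_sum_of_nonneg fun w _ => by positivity).symm
    _ ≤ ENNReal.ofReal c := by
        refine ENNReal.ofReal_le_ofReal ?_
        rw [← Finset.mul_sum]
        exact mul_le_of_le_one_right hc (C.sum_two_pow_neg_len_le_one l)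

/-! ### Alarms and renewal -/

/-- Given, for each length `l`, a set `A l` of alarming words, an alarm is raised at time `n` if a
nonempty alarming word ends there. -/
def Alarm (A : (l : ℕ) → Set (Fin l → X)) (ω : ℕ → X) (n : ℕ) : Prop :=
  ∃ s l, 1 ≤ l ∧ s + l = n ∧ block ω s l ∈ A l

theorem block_congr {ω ω' : ℕ → X} {s l j : ℕ} (h : block ω 0 j = block ω' 0 j)
    (hj : s + l ≤ j) : block ω s l = block ω' s l := by
  funext i
  have := congrFun h ⟨s + i, by omega⟩
  simpa [block] using this

theorem alarm_congr {A : (l : ℕ) → Set (Fin l → X)} {ω ω' : ℕ → X} {n j : ℕ}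
    (h : block ω 0 j = block ω' 0 j) (hj : n ≤ j) : Alarm A ω n ↔ Alarm A ω' n := by
  refine exists_congr fun s => exists_congr fun l => and_congr_right fun _ =>
    and_congr_right fun hn => ?_
  rw [block_congr h (by omega)]

section Measure

variable [MeasurableSpace X] [Finite X] [MeasurableSingletonClass X]

theorem measurableSet_alarm (A : (l : ℕ) → Set (Fin l → X)) (n : ℕ) :
    MeasurableSet {ω | Alarm A ω n} := by
  simp only [Alarm, Set.ofPred_exists]
  exact .iUnion fun s => .iUnion fun l =>
    (MeasurableSet.const _).inter ((MeasurableSet.const _).inter (measurableSet_block s l _))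

end Measure

open Classical in
/-- The number of positions `s < n` at which an alarming word starts that ends by time `n`. -/
noncomputable def startCount (A : (l : ℕ) → Set (Fin l → X)) (n : ℕ) (ω : ℕ → X) : ℝ≥0∞ :=
  ∑ s ∈ Finset.range n, if ∃ l, 1 ≤ l ∧ s + l ≤ n ∧ block ω s l ∈ A l then 1 else 0

/-- The first alarm is raised at time `j`. -/
def FirstAlarm (A : (l : ℕ) → Set (Fin l → X)) (ω : ℕ → X) (j : ℕ) : Prop :=
  Alarm A ω j ∧ ∀ k < j, ¬ Alarm A ω k

theorem FirstAlarm.unique {A : (l : ℕ) → Set (Fin l → X)} {ω : ℕ → X} {j k : ℕ}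
    (hj : FirstAlarm A ω j) (hk : FirstAlarm A ω k) : j = k := by
  rcases lt_trichotomy j k with h | h | h
  · exact absurd hj.1 (hk.2 j h)
  · exact h
  · exact absurd hk.1 (hj.2 k h)

theorem firstAlarm_congr {A : (l : ℕ) → Set (Fin l → X)} {ω ω' : ℕ → X} {j : ℕ}
    (h : block ω 0 j = block ω' 0 j) : FirstAlarm A ω j ↔ FirstAlarm A ω' j :=
  and_congr (alarm_congr h le_rfl)
    (forall_congr' fun _ => imp_congr_right fun hk => not_congr (alarm_congr h (le_of_lt hk)))

open Classical in
/-- Restarting after the first alarm: the word that raised it contributes one starting position,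
and the sequence after it contributes its own. -/
theorem sum_firstAlarm_le_startCount (A : (l : ℕ) → Set (Fin l → X)) (n : ℕ) (ω : ℕ → X) :
    ∑ j ∈ Finset.range (n + 1), (if FirstAlarm A ω j then 1 else 0) *
      (1 + startCount A (n - j) (shift j ω)) ≤ startCount A n ω := by
  by_cases h : ∃ j ≤ n, FirstAlarm A ω j
  · obtain ⟨j, hjn, hj⟩ := h
    rw [Finset.sum_eq_single j]
    · obtain ⟨m, rfl⟩ := Nat.exists_eq_add_of_le hjn
      rw [if_pos hj, one_mul, Nat.add_sub_cancel_left, startCount, startCount,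
        Finset.sum_range_add]
      refine add_le_add ?_ (Finset.sum_le_sum fun i _ => ?_)
      · obtain ⟨s, l, hl, hsl, hA⟩ := hj.1
        refine le_trans ?_ (Finset.single_le_sum (fun _ _ => zero_le)
          (Finset.mem_range.2 (by omega : s < j)))
        rw [if_pos ⟨l, hl, by omega, hA⟩]
      · split_ifs with h1 h2 h2
        · exact le_rfl
        · obtain ⟨l, hl, hil, hA⟩ := h1
          exact absurd ⟨l, hl, by omega, by rwa [block_shift] at hA⟩ h2
        · exact zero_le
        · exact le_rfl
    · intro k _ hk
      rw [if_neg fun h => hk (h.unique hj), zero_mul]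
    · intro hj'
      exact absurd (Finset.mem_range.2 (by omega)) hj'
  · rw [Finset.sum_eq_zero]
    · exact zero_le
    · intro j hj
      rw [if_neg, zero_mul]
      exact fun hj' => h ⟨j, by simpa [Nat.lt_succ_iff] using hj, hj'⟩

open Classical in
/-- If the first alarm comes at time `T`, then `(n + 1 - T)⁺ + T ≥ n + 1`. -/
theorem add_one_le_sum_firstAlarm_add (A : (l : ℕ) → Set (Fin l → X)) (n : ℕ) (ω : ℕ → X) :
    (n + 1 : ℝ≥0∞) ≤ ∑ j ∈ Finset.range (n + 1), (if FirstAlarm A ω j then 1 else 0) *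
      ((n - j : ℕ) + 1 : ℝ≥0∞) + firstTime (Alarm A ω) := by
  by_cases h : ∃ j ≤ n, FirstAlarm A ω j
  · obtain ⟨j, hjn, hj⟩ := h
    have h1 : ((n - j : ℕ) + 1 : ℝ≥0∞) ≤ ∑ j ∈ Finset.range (n + 1),
        (if FirstAlarm A ω j then 1 else 0) * ((n - j : ℕ) + 1 : ℝ≥0∞) := by
      refine le_trans ?_ (Finset.single_le_sum (fun _ _ => zero_le)
        (Finset.mem_range.2 (by omega : j < n + 1)))
      rw [if_pos hj, one_mul]
    have h2 : (j : ℝ≥0∞) ≤ (firstTime (Alarm A ω) : ℝ≥0∞) := by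
      have : (j : ℕ∞) ≤ firstTime (Alarm A ω) := le_iInf₂ fun k hk => by
        have : j ≤ k := by
          by_contra! hkj
          exact hj.2 k hkj hk
        exact_mod_cast this
      exact_mod_cast ENat.toENNReal_le.2 this
    refine le_trans ?_ (add_le_add h1 h2)
    have : n + 1 = (n - j) + 1 + j := by omega
    exact_mod_cast this.le
  · have : ((n : ℕ∞)) < firstTime (Alarm A ω) := by
      rw [lt_firstTime_iff]
      intro k
      induction k using Nat.strong_induction_on with
      | _ k ih =>
        intro hk hA
        exact h ⟨k, hk, hA, fun i hi => ih i hi (by omega)⟩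
    refine le_add_of_nonneg_of_le zero_le ?_
    have := ENat.toENNReal_le.2 (Order.add_one_le_of_lt this)
    simpa using this

section Measure

variable [MeasurableSpace X] [Finite X] [MeasurableSingletonClass X]

theorem measurableSet_exists_block (A : (l : ℕ) → Set (Fin l → X)) (s n : ℕ) :
    MeasurableSet {ω : ℕ → X | ∃ l, 1 ≤ l ∧ s + l ≤ n ∧ block ω s l ∈ A l} := by
  simp only [Set.ofPred_exists]
  exact .iUnion fun l =>
    (MeasurableSet.const _).inter ((MeasurableSet.const _).inter (measurableSet_block s l _))

theorem measurable_startCount (A : (l : ℕ) → Set (Fin l → X)) (n : ℕ) :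
    Measurable (startCount A n) := by
  unfold startCount
  exact Finset.measurable_fun_sum _ fun s _ =>
    Measurable.ite (measurableSet_exists_block A s n) measurable_const measurable_const

theorem lintegral_startCount_le (A : (l : ℕ) → Set (Fin l → X)) (μ : PMF X) {α : ℝ≥0∞}
    (hα : noChange μ {ω | ∃ l, 1 ≤ l ∧ block ω 0 l ∈ A l} ≤ α) (n : ℕ) :
    ∫⁻ ω, startCount A n ω ∂noChange μ ≤ n * α := by
  classical
  simp only [startCount]
  rw [lintegral_finsetSum _ fun s _ =>
    Measurable.ite (measurableSet_exists_block A s n) measurable_const measurable_const]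
  refine (Finset.sum_le_card_nsmul _ _ α fun s _ => ?_).trans (by simp)
  have : ∫⁻ ω, (if ∃ l, 1 ≤ l ∧ s + l ≤ n ∧ block ω s l ∈ A l then 1 else 0) ∂noChange μ =
      noChange μ {ω | ∃ l, 1 ≤ l ∧ s + l ≤ n ∧ block ω s l ∈ A l} := by
    rw [← lintegral_indicator_one (measurableSet_exists_block A s n)]
    exact lintegral_congr fun ω => by simp [Set.indicator_apply]
  rw [this]
  refine le_trans (measure_mono ?_) ((noChange_shift μ s ?_).trans_le hα)
  · rintro ω ⟨l, hl, -, hA⟩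
    exact ⟨l, hl, by simpa [block_shift] using hA⟩
  · simp only [Set.ofPred_exists]
    exact .iUnion fun l => (MeasurableSet.const _).inter (measurableSet_block 0 l _)

/-- If some alarming word starts at a given position with probability at most `α`, then
the mean time to the first alarm of an i.i.d. sequence is at least `1 / α`. The expected number
`v n` of starting positions up to time `n` is at most `n α`; on the other hand it satisfies the
renewal inequality `v n ≥ ∑ j ≤ n, P(T = j) (1 + v (n - j))`, which by induction gives
`(v n + 1) E T ≥ n + 1`. -/
theorem one_le_mul_lintegral_firstTime (A : (l : ℕ) → Set (Fin l → X)) (μ : PMF X) {α : ℝ≥0∞}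
    (hα0 : α ≠ 0)     (hα : noChange μ {ω | ∃ l, 1 ≤ l ∧ block ω 0 l ∈ A l} ≤ α) :
    1 ≤ α * ∫⁻ ω, (firstTime (Alarm A ω) : ℝ≥0∞) ∂noChange μ := by
  classical
  set e := ∫⁻ ω, (firstTime (Alarm A ω) : ℝ≥0∞) ∂noChange μ with he
  set v : ℕ → ℝ≥0∞ := fun n => ∫⁻ ω, startCount A n ω ∂noChange μ with hv
  set p : ℕ → ℝ≥0∞ := fun j => ∫⁻ ω, (if FirstAlarm A ω j then 1 else 0) ∂noChange μ with hp
  have hfac : ∀ j, (fun ω => if FirstAlarm A ω j then (1 : ℝ≥0∞) else 0).FactorsThrough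
      fun ω => block ω 0 j := by
    intro j ω ω' h
    have := firstAlarm_congr (A := A) (show block ω 0 j = block ω' 0 j from h)
    by_cases h' : FirstAlarm A ω' j <;> simp [this, h']
  have hmeas : ∀ j, MeasurableSet {ω | FirstAlarm A ω j} := fun j => by
    have : {ω | FirstAlarm A ω j} = {ω | Alarm A ω j} ∩ ⋂ k, ⋂ _ : k < j, {ω | Alarm A ω k}ᶜ := by
      ext ω
      simp [FirstAlarm]
    rw [this]
    exact (measurableSet_alarm A j).inter
      (.iInter fun k => .iInter fun _ => (measurableSet_alarm A k).compl)
  have hite : ∀ j, Measurable fun ω => if FirstAlarm A ω j then (1 : ℝ≥0∞) else 0 := fun j =>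
    Measurable.ite (hmeas j) measurable_const measurable_const
  have hrenew : ∀ n, ∑ j ∈ Finset.range (n + 1), p j * (1 + v (n - j)) ≤ v n := by
    intro n
    refine le_trans (le_of_eq ?_) (lintegral_mono (sum_firstAlarm_le_startCount A n))
    have hF : ∀ k, Measurable fun ω => 1 + startCount A k ω := fun k =>
      measurable_const.add (measurable_startCount A k)
    have hm : ∀ j, Measurable fun ω => (if FirstAlarm A ω j then (1 : ℝ≥0∞) else 0) *
        (1 + startCount A (n - j) (shift j ω)) := fun j =>
      (hite j).mul ((hF (n - j)).comp (measurable_shift j))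
    rw [lintegral_finsetSum _ fun j _ => hm j]
    refine Finset.sum_congr rfl fun j _ => ?_
    have := lintegral_mul_shift (fun _ => μ.toMeasure) (hfac j) (hF (n - j))
    refine Eq.trans ?_ this.symm
    rw [lintegral_add_left measurable_const]
    simp [hp, hv, noChange]
  have hmean : ∀ n : ℕ, (n + 1 : ℝ≥0∞) ≤
      ∑ j ∈ Finset.range (n + 1), p j * ((n - j : ℕ) + 1) + e := by
    intro n
    have := lintegral_mono (μ := noChange μ) (add_one_le_sum_firstAlarm_add A n)
    rw [lintegral_const, measure_univ, mul_one,
      lintegral_add_left (Finset.measurable_fun_sum _ fun j _ => (hite j).mul_const _),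
      lintegral_finsetSum _ fun j _ => (hite j).mul_const _] at this
    simpa only [lintegral_mul_const _ (hite _)] using this
  have hind : ∀ n : ℕ, (n + 1 : ℝ≥0∞) ≤ (v n + 1) * e := by
    intro n
    induction n using Nat.strong_induction_on with
    | _ n ih =>
      -- no alarm at time `0`: the sum involves `v` only at smaller arguments
      have hp0 : p 0 = 0 := by
        have : ∀ ω, ¬ FirstAlarm A ω 0 := by
          rintro ω ⟨⟨s, l, h1, h2, -⟩, -⟩
          omega
        simp [hp, this]
      calc (n + 1 : ℝ≥0∞) ≤ ∑ j ∈ Finset.range (n + 1), p j * ((n - j : ℕ) + 1) + e := hmean n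
        _ ≤ ∑ j ∈ Finset.range (n + 1), p j * ((1 + v (n - j)) * e) + e := by
            refine add_le_add_left (Finset.sum_le_sum fun j hj => ?_) _
            rcases Nat.eq_zero_or_pos j with rfl | hj0
            · simp [hp0]
            · have hj : j < n + 1 := by simpa using hj
              refine mul_le_mul_right ?_ _
              rw [add_comm 1]
              exact ih (n - j) (by omega)
        _ = (∑ j ∈ Finset.range (n + 1), p j * (1 + v (n - j)) + 1) * e := by
            rw [add_mul, one_mul, Finset.sum_mul]
            simp only [mul_assoc]
        _ ≤ (v n + 1) * e := by gcongr; exact hrenew n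
  by_cases htop : e = ⊤
  · rw [htop, ENNReal.mul_top hα0]
    exact le_top
  · by_contra! hlt
    have hlin : ∀ n : ℕ, (n : ℝ) + 1 ≤ n * (α * e).toReal + e.toReal := by
      intro n
      have h1 : (n + 1 : ℝ≥0∞) ≤ n * (α * e) + e := by
        refine (hind n).trans ?_
        rw [add_mul, one_mul, ← mul_assoc]
        gcongr
        exact lintegral_startCount_le A μ hα n
      have hne : (n : ℝ≥0∞) * (α * e) ≠ ⊤ := ENNReal.mul_ne_top (by simp) hlt.ne_top
      have h2 := ENNReal.toReal_mono (by simp [hne, htop]) h1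
      rw [ENNReal.toReal_add hne htop, ENNReal.toReal_mul] at h2
      simpa [ENNReal.toReal_add] using h2
    have ha : (α * e).toReal < 1 := by
      simpa using (ENNReal.toReal_lt_toReal hlt.ne_top ENNReal.one_ne_top).2 hlt
    obtain ⟨n, hn⟩ := exists_nat_gt (e.toReal / (1 - (α * e).toReal))
    rw [div_lt_iff₀ (by linarith)] at hn
    linarith [hlin n]

end Measure

end FalseAlarm

/-! ### Large deviations of sums over blocks -/

section LargeDeviations

variable {X : Type*} [Fintype X] [MeasurableSpace X] [MeasurableSingletonClass X]

theorem integral_noChange_eval (μ : PMF X) (f : X → ℝ) (i : ℕ) :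
    ∫ ω, f (ω i) ∂noChange μ = ∑ a, (μ a).toReal * f a := by
  have h := Measure.infinitePi_map_eval (fun _ : ℕ => μ.toMeasure) i
  have hf : Measurable f := measurable_of_finite f
  calc ∫ ω, f (ω i) ∂noChange μ
      = ∫ a, f a ∂(noChange μ).map (fun ω => ω i) :=
        (integral_map (measurable_pi_apply i).aemeasurable hf.aestronglyMeasurable).symm
    _ = ∑ a, (μ a).toReal * f a := by
        rw [noChange, h, PMF.integral_eq_sum]
        simp

/-- Hoeffding's inequality for a function of i.i.d. letters. -/
theorem exists_hoeffding (μ : PMF X) (f : X → ℝ) :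
    ∃ c : ℝ, 0 < c ∧ ∀ (n : ℕ) (t : ℝ), 0 ≤ t →
      noChange μ {ω | block ω 0 n ∈ {w | n * (∑ a, (μ a).toReal * f a) + t ≤ ∑ i, f (w i)}} ≤
        ENNReal.ofReal (Real.exp (-(c * t ^ 2 / n))) := by
  set d := ∑ a, (μ a).toReal * f a with hd
  -- the summand `1` keeps the variance proxy positive when `f = 0`
  set B : ℝ := ∑ a, |f a| + 1 with hB
  have hfB : ∀ a, |f a| ≤ B := fun a => by
    have := Finset.single_le_sum (fun b _ => abs_nonneg (f b)) (Finset.mem_univ a)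
    linarith
  have hB0 : 0 < B := by positivity
  have hf : Measurable f := measurable_of_finite f
  have hind : iIndepFun (fun (i : ℕ) (ω : ℕ → X) => f (ω i) - d) (noChange μ) :=
    iIndepFun_infinitePi (X := fun _ a => f a - d) (fun _ => hf.sub_const d)
  have hsub : ∀ i : ℕ, HasSubgaussianMGF (fun ω : ℕ → X => f (ω i) - d)
      ((‖B - -B‖₊ / 2) ^ 2) (noChange μ) := fun i => by
    have := hasSubgaussianMGF_of_mem_Icc (μ := noChange μ) (X := fun ω : ℕ → X => f (ω i))
      (a := -B) (b := B) (hf.comp (measurable_pi_apply i)).aemeasurable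
      (ae_of_all _ fun ω => abs_le.1 (hfB (ω i)))
    rwa [integral_noChange_eval] at this
  refine ⟨1 / (2 * B ^ 2), by positivity, fun n t ht => ?_⟩
  have h := HasSubgaussianMGF.measure_sum_range_ge_le_of_iIndepFun hind (n := n)
    (fun i _ => hsub i) ht
  rw [← ENNReal.ofReal_toReal (measure_ne_top (noChange μ) _)]
  refine ENNReal.ofReal_le_ofReal (le_trans (le_of_eq ?_) (h.trans (le_of_eq ?_)))
  · change (noChange μ).real _ = _
    congr 1
    ext ω
    simp only [Set.mem_ofPred_eq, Finset.sum_sub_distrib, Finset.sum_const, Finset.card_range,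
      nsmul_eq_mul, block, zero_add, Finset.sum_range]
    constructor <;> intro h' <;> linarith
  · congr 1
    have : ((‖B - -B‖₊ / 2 : NNReal) : ℝ) = B := by
      push_cast
      rw [Real.norm_eq_abs, abs_of_pos (by linarith)]
      ring
    push_cast at this ⊢
    rw [this]
    rcases Nat.eq_zero_or_pos n with rfl | hn
    · simp
    · field_simp

end LargeDeviations

/-! ### Logarithms, scores and divergence -/

section Score

theorem log2_of_ne {p : ℝ≥0∞} (h0 : p ≠ 0) (ht : p ≠ ⊤) :
    log2 p = ((Real.logb 2 p.toReal : ℝ) : EReal) := by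
  rw [log2, ENNReal.log_pos_real h0 ht, Real.logb, EReal.coe_div]

theorem log2_zero : log2 0 = ⊥ := by
  rw [log2, ENNReal.log_zero, EReal.bot_div_of_pos_ne_top]
  · exact_mod_cast Real.log_pos one_lt_two
  · exact EReal.coe_ne_top _

theorem log2_top : log2 ⊤ = ⊤ := by
  rw [log2, ENNReal.log_top, EReal.top_div_of_pos_ne_top]
  · exact_mod_cast Real.log_pos one_lt_two
  · exact EReal.coe_ne_top _

theorem log2_ne_bot {p : ℝ≥0∞} (h0 : p ≠ 0) : log2 p ≠ ⊥ := by
  by_cases ht : p = ⊤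
  · simp [ht, log2_top]
  · simp [log2_of_ne h0 ht]

variable {X : Type*}

theorem wordProb_ne_top {ν : X → ℝ≥0∞} (hν : ∀ a, ν a ≠ ⊤) {l : ℕ} (w : Fin l → X) :
    wordProb ν w ≠ ⊤ := ENNReal.prod_ne_top fun i _ => hν (w i)

theorem wordProb_ne_zero_iff {ν : X → ℝ≥0∞} {l : ℕ} {w : Fin l → X} :
    wordProb ν w ≠ 0 ↔ ∀ i, ν (w i) ≠ 0 := by
  simp [wordProb, Finset.prod_eq_zero_iff]

theorem toReal_wordProb (ν : X → ℝ≥0∞) {l : ℕ} (w : Fin l → X) :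
    (wordProb ν w).toReal = ∏ i, (ν (w i)).toReal := ENNReal.toReal_prod _ _

theorem score_eq_coe (C : PrefixCode X) {ν : X → ℝ≥0∞} (lam : ℝ) {l : ℕ} {w : Fin l → X}
    (h0 : wordProb ν w ≠ 0) (ht : wordProb ν w ≠ ⊤) :
    score C ν lam w =
      ((-(C.len w : ℝ) - Real.logb 2 (wordProb ν w).toReal - l * lam : ℝ) : EReal) := by
  rw [score, log2_of_ne h0 ht]
  norm_cast

theorem score_eq_top (C : PrefixCode X) {ν : X → ℝ≥0∞} (lam : ℝ) {l : ℕ} {w : Fin l → X}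
    (h0 : wordProb ν w = 0) : score C ν lam w = ⊤ := by
  rw [score, h0, log2_zero, ← EReal.coe_neg, EReal.coe_sub_bot, EReal.top_sub_coe]

/-- A word of high score has small probability compared with `2 ^ (-L)`. -/
theorem mul_wordProb_le_of_le_score (C : PrefixCode X) {ν : X → ℝ≥0∞} {lam γ : ℝ} (hγ : 0 < γ)
    {l : ℕ} {w : Fin l → X} (h0 : wordProb ν w ≠ 0) (ht : wordProb ν w ≠ ⊤)
    (h : ((Real.logb 2 γ : ℝ) : EReal) ≤ score C ν lam w) :
    γ * (wordProb ν w).toReal ≤ ((2 : ℝ) ^ (-lam)) ^ l * (1 / 2 : ℝ) ^ C.len w := by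
  have hp : 0 < (wordProb ν w).toReal := ENNReal.toReal_pos h0 ht
  rw [score_eq_coe C lam h0 ht, EReal.coe_le_coe_iff] at h
  have h1 : Real.logb 2 (γ * (wordProb ν w).toReal) ≤ -(C.len w : ℝ) - l * lam := by
    rw [Real.logb_mul hγ.ne' hp.ne']
    linarith
  rw [Real.logb_le_iff_le_rpow one_lt_two (by positivity)] at h1
  refine h1.trans (le_of_eq ?_)
  rw [← Real.rpow_natCast, ← Real.rpow_mul two_pos.le, one_div, inv_pow, ← Real.rpow_natCast 2,
    ← Real.rpow_neg two_pos.le, ← Real.rpow_add two_pos]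
  congr 1
  ring

section KL

variable [Fintype X] {μ ν : X → ℝ≥0∞}

theorem klBits_eq_coe (hμ : ∀ a, μ a ≠ ⊤) (hν : ∀ a, ν a ≠ ⊤) (h : ∀ a, μ a ≠ 0 → ν a ≠ 0) :
    klBits μ ν =
      ((∑ a, (μ a).toReal * Real.logb 2 ((μ a).toReal / (ν a).toReal) : ℝ) : EReal) := by
  have : ∀ a, ((μ a : ℝ≥0∞) : EReal) * log2 (μ a / ν a) =
      (((μ a).toReal * Real.logb 2 ((μ a).toReal / (ν a).toReal) : ℝ) : EReal) := by
    intro a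
    by_cases h0 : μ a = 0
    · simp [h0]
    · rw [log2_of_ne (ENNReal.div_ne_zero.2 ⟨h0, hν a⟩) (ENNReal.div_ne_top (hμ a) (h a h0)),
        EReal.coe_mul, ENNReal.toReal_div, EReal.coe_ennreal_toReal (hμ a)]
  rw [klBits, Finset.sum_congr rfl fun a _ => this a]
  exact (map_sum (⟨⟨Real.toEReal, EReal.coe_zero⟩, EReal.coe_add⟩ : ℝ →+ EReal) _ _).symm

theorem klBits_eq_top (hμ : ∀ a, μ a ≠ ⊤) (hν : ∀ a, ν a ≠ ⊤) {b : X} (hμb : μ b ≠ 0)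
    (hνb : ν b = 0) :
    klBits μ ν = ⊤ := by
  classical
  have hbot : ∀ a, ((μ a : ℝ≥0∞) : EReal) * log2 (μ a / ν a) ≠ ⊥ := by
    intro a
    by_cases h0 : μ a = 0
    · simp [h0]
    · have h1 := log2_ne_bot (ENNReal.div_ne_zero.2 ⟨h0, hν a⟩)
      rw [EReal.mul_ne_bot]
      exact ⟨.inl (EReal.coe_ennreal_ne_bot _), .inr h1,
        .inl (by simpa using hμ a), .inl (EReal.coe_ennreal_nonneg _)⟩
  rw [klBits, ← Finset.add_sum_erase _ _ (Finset.mem_univ b), hνb, ENNReal.div_zero hμb, log2_top,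
    EReal.mul_top_of_pos (by simpa [pos_iff_ne_zero] using hμb)]
  refine EReal.top_add_of_ne_bot ?_
  exact Finset.sum_induction _ (· ≠ ⊥) (fun x y hx hy => by simp [EReal.add_eq_bot_iff, hx, hy])
    (by simp) fun a _ => hbot a

end KL

/-! ### The stopping time as a first alarm -/

/-- The words whose score with respect to `ν` reaches the threshold `log γ`. -/
def highScore (C : PrefixCode X) (ν : X → ℝ≥0∞) (lam γ : ℝ) (l : ℕ) : Set (Fin l → X) :=
  {w | ((Real.logb 2 γ : ℝ) : EReal) ≤ score C ν lam w}

theorem mem_highScore {C : PrefixCode X} {ν : X → ℝ≥0∞} {lam γ : ℝ} {l : ℕ} {w : Fin l → X} :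
    w ∈ highScore C ν lam γ l ↔ ((Real.logb 2 γ : ℝ) : EReal) ≤ score C ν lam w := Iff.rfl

variable [DecidableEq X]

theorem stopTime_eq_firstTime (C : PrefixCode X) (lam : ℝ) (n₀ : ℕ) (γ : ℝ) (ω : ℕ → X) :
    stopTime C lam n₀ γ ω =
      firstTime (Alarm (highScore C (empirical (block ω 0 n₀)) lam γ) (shift n₀ ω)) := by
  have : ∀ n, (1 ≤ n ∧ ((Real.logb 2 γ : ℝ) : EReal) ≤ statistic C lam n₀ ω n) ↔
      Alarm (highScore C (empirical (block ω 0 n₀)) lam γ) (shift n₀ ω) n := by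
    intro n
    rw [statistic, Finset.le_sup_iff (EReal.bot_lt_coe _)]
    constructor
    · rintro ⟨-, k, hk, h⟩
      rw [Finset.mem_Icc] at hk
      refine ⟨k - 1, n - k + 1, by omega, by omega, ?_⟩
      rw [block_shift, ← Nat.add_sub_assoc hk.1]
      exact h
    · rintro ⟨s, l, hl, rfl, h⟩
      refine ⟨by omega, s + 1, Finset.mem_Icc.2 ⟨by omega, by omega⟩, ?_⟩
      rw [block_shift] at h
      have h1 : s + l - (s + 1) + 1 = l := by omega
      rw [h1]
      exact h
  simp only [stopTime, this, firstTime]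

theorem one_le_stopTime (C : PrefixCode X) (lam : ℝ) (n₀ : ℕ) (γ : ℝ) (ω : ℕ → X) :
    (1 : ℝ≥0∞) ≤ (stopTime C lam n₀ γ ω : ℝ≥0∞) := by
  have : ((1 : ℕ) : ℕ∞) ≤ stopTime C lam n₀ γ ω :=
    le_iInf₂ fun n hn => by exact_mod_cast hn.1
  simpa using ENat.toENNReal_le.2 this

theorem empirical_le_one {n : ℕ} (x : Fin n → X) (a : X) : empirical x a ≤ 1 := by
  refine ENNReal.div_le_of_le_mul ?_
  rw [one_mul]
  have : (Finset.univ.filter fun i => x i = a).card ≤ n :=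
    (Finset.card_filter_le _ _).trans (by simp)
  exact_mod_cast this

theorem empirical_ne_top {n : ℕ} (x : Fin n → X) (a : X) : empirical x a ≠ ⊤ :=
  ne_top_of_le_ne_top ENNReal.one_ne_top (empirical_le_one x a)

end Score

/-! ### The bound for the mean time to a false alarm -/

section FalseAlarmTime

variable {X : Type*} [Fintype X] [MeasurableSpace X] [MeasurableSingletonClass X]

/-- If `μ ≤ β ν`, then an i.i.d. sequence with law `μ` has some initial word of high score with
probability at most `1 / (γ (2 ^ (λ - log β) - 1))`. -/
theorem noChange_exists_highScore_le (C : PrefixCode X) (μ : PMF X) {ν : X → ℝ≥0∞}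
    (hν : ∀ a, ν a ≠ ⊤) {β lam γ : ℝ} (hβ : 0 < β)
    (hμν : ∀ a, (μ a).toReal ≤ β * (ν a).toReal) (hlam : Real.logb 2 β < lam) (hγ : 0 < γ) :
    noChange μ {ω | ∃ l, 1 ≤ l ∧ block ω 0 l ∈ highScore C ν lam γ l} ≤
      ENNReal.ofReal (γ⁻¹ * (1 / ((2 : ℝ) ^ (lam - Real.logb 2 β) - 1))) := by
  set r : ℝ := β * (2 : ℝ) ^ (-lam) with hr
  have hr0 : 0 < r := by positivity
  have hrinv : r⁻¹ = (2 : ℝ) ^ (lam - Real.logb 2 β) := by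
    rw [Real.rpow_sub two_pos, Real.rpow_logb two_pos (by norm_num) hβ, hr,
      Real.rpow_neg two_pos.le]
    field_simp
  have hr1 : r < 1 := by
    rw [← inv_inv r, hrinv]
    exact inv_lt_one_of_one_lt₀ (Real.one_lt_rpow one_lt_two (by linarith))
  have hblock : ∀ l, noChange μ {ω | block ω 0 l ∈ highScore C ν lam γ l} ≤
      ENNReal.ofReal (γ⁻¹ * r ^ l) := by
    intro l
    refine noChange_block_mem_le_of_kraft C μ (by positivity) fun w hw hw0 => ?_
    have hμ0 := wordProb_ne_zero_iff.1 hw0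
    have hν0 : wordProb ν w ≠ 0 := wordProb_ne_zero_iff.2 fun i h0 => by
      have h1 := hμν (w i)
      rw [h0] at h1
      have h2 := ENNReal.toReal_pos (hμ0 i) (μ.apply_ne_top _)
      simp at h1
      linarith
    have h1 := mul_wordProb_le_of_le_score C hγ hν0 (wordProb_ne_top hν w) hw
    have h2 : (wordProb μ w).toReal ≤ β ^ l * (wordProb ν w).toReal := by
      rw [toReal_wordProb, toReal_wordProb]
      refine (Finset.prod_le_prod (fun i _ => ENNReal.toReal_nonneg)
        fun i _ => hμν (w i)).trans (le_of_eq ?_)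
      rw [Finset.prod_mul_distrib]
      simp
    calc (wordProb μ w).toReal ≤ β ^ l * (wordProb ν w).toReal := h2
      _ = γ⁻¹ * β ^ l * (γ * (wordProb ν w).toReal) := by field_simp
      _ ≤ γ⁻¹ * β ^ l * (((2 : ℝ) ^ (-lam)) ^ l * (1 / 2 : ℝ) ^ C.len w) := by gcongr
      _ = γ⁻¹ * r ^ l * (1 / 2 : ℝ) ^ C.len w := by rw [hr, mul_pow]; ring
  have hsum : HasSum (fun k : ℕ => γ⁻¹ * r ^ (k + 1))
      (γ⁻¹ * (1 / ((2 : ℝ) ^ (lam - Real.logb 2 β) - 1))) := by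
    have h := (hasSum_geometric_of_lt_one hr0.le hr1).mul_left (γ⁻¹ * r)
    have h1 : (fun k : ℕ => γ⁻¹ * r ^ (k + 1)) = fun k => γ⁻¹ * r * r ^ k := by
      funext k
      rw [pow_succ]
      ring
    have h2 : γ⁻¹ * (1 / ((2 : ℝ) ^ (lam - Real.logb 2 β) - 1)) = γ⁻¹ * r * (1 - r)⁻¹ := by
      rw [← hrinv]
      have : 1 - r ≠ 0 := by linarith
      have : r⁻¹ - 1 ≠ 0 := (sub_pos.2 ((one_lt_inv₀ hr0).2 hr1)).ne'
      field_simp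
    rw [h1, h2]
    exact h
  calc noChange μ {ω | ∃ l, 1 ≤ l ∧ block ω 0 l ∈ highScore C ν lam γ l}
      ≤ noChange μ (⋃ k : ℕ, {ω | block ω 0 (k + 1) ∈ highScore C ν lam γ (k + 1)}) := by
        refine measure_mono ?_
        rintro ω ⟨l, hl, h⟩
        obtain ⟨k, rfl⟩ := Nat.exists_eq_add_of_le' hl
        exact Set.mem_iUnion.2 ⟨k, h⟩
    _ ≤ ∑' k : ℕ, ENNReal.ofReal (γ⁻¹ * r ^ (k + 1)) :=
        (measure_iUnion_le _).trans (ENNReal.tsum_le_tsum fun k => hblock (k + 1))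
    _ = _ := by
        rw [← ENNReal.ofReal_tsum_of_nonneg (fun k => by positivity) hsum.summable, hsum.tsum_eq]

variable [DecidableEq X]

/-- The stopping time restricted to the event that the first samples are `x`: the later
samples are independent of the empirical distribution used by the test. -/
theorem setLIntegral_stopTime (C : PrefixCode X) (μ : PMF X) (lam : ℝ) {n₀ : ℕ} (γ : ℝ)
    (x : Fin n₀ → X) :
    ∫⁻ ω in {ω | block ω 0 n₀ = x}, (stopTime C lam n₀ γ ω : ℝ≥0∞) ∂noChange μ =
      noChange μ {ω | block ω 0 n₀ = x} *
        ∫⁻ ω, (firstTime (Alarm (highScore C (empirical x) lam γ) ω) : ℝ≥0∞) ∂noChange μ := by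
  refine Eq.trans ?_ (setLIntegral_block_shift (fun _ => μ.toMeasure) x
    (measurable_firstTime fun n => measurableSet_alarm _ n))
  refine setLIntegral_congr_fun (measurableSet_block 0 n₀ {x}) fun ω hω => ?_
  have hω : block ω 0 n₀ = x := hω
  simp only [stopTime_eq_firstTime, hω]

/-- The lower bound for the mean time to a false alarm. On the event that the empirical
distribution is within `δ` of `μ₀` the conditional mean is at least the reciprocal of the
probability that some initial word has a high score. -/
theorem le_lintegral_stopTime (C : PrefixCode X) (μ₀ : PMF X) (lam : ℝ) (n₀ : ℕ)
    (a : X) (δ β ε₀ γ : ℝ) (hmin : ∀ b, μ₀ b ≠ 0 → μ₀ a ≤ μ₀ b)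
    (hδa : δ < (μ₀ a).toReal) (hδ : 0 < δ)
    (hβ : β = (μ₀ a).toReal / ((μ₀ a).toReal - δ))
    (hε : (noChange μ₀).real {ω | ∃ b, δ < |(empirical (block ω 0 n₀) b).toReal
      - (μ₀ b).toReal|} ≤ ε₀)
    (hlam : Real.logb 2 β < lam) (hγ : 1 < γ) :
    ENNReal.ofReal (γ / (1 / ((2 : ℝ) ^ (lam - Real.logb 2 β) - 1) + ε₀ * γ)) ≤
      ∫⁻ ω, (stopTime C lam n₀ γ ω : ℝ≥0∞) ∂noChange μ₀ := by
  classical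
  have hγ0 : 0 < γ := by linarith
  set s := 1 / ((2 : ℝ) ^ (lam - Real.logb 2 β) - 1) with hs
  have hs0 : 0 < s := by
    have := Real.one_lt_rpow one_lt_two (show 0 < lam - Real.logb 2 β by linarith)
    exact one_div_pos.2 (by linarith)
  set q := γ⁻¹ * s with hq
  have hq0 : 0 < q := by positivity
  have hβ0 : 0 < β := by rw [hβ]; exact div_pos (by linarith) (by linarith)
  have hε0 : 0 ≤ ε₀ := measureReal_nonneg.trans hε
  set e := ∫⁻ ω, (stopTime C lam n₀ γ ω : ℝ≥0∞) ∂noChange μ₀ with he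
  set G : Finset (Fin n₀ → X) :=
    Finset.univ.filter fun x => ∀ b, |(empirical x b).toReal - (μ₀ b).toReal| ≤ δ with hG
  have hbound : γ / (s + ε₀ * γ) = 1 / (q + ε₀) := by
    rw [hq]
    field_simp
  have hone : 1 ≤ e := by
    have := lintegral_mono (μ := noChange μ₀) (one_le_stopTime C lam n₀ γ)
    simpa using this
  have hgood : ∀ x ∈ G, ENNReal.ofReal q⁻¹ ≤
      ∫⁻ ω, (firstTime (Alarm (highScore C (empirical x) lam γ) ω) : ℝ≥0∞) ∂noChange μ₀ := by
    intro x hx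
    have hx : ∀ b, |(empirical x b).toReal - (μ₀ b).toReal| ≤ δ := by simpa [hG] using hx
    have hμν : ∀ b, (μ₀ b).toReal ≤ β * (empirical x b).toReal := by
      intro b
      by_cases hb : μ₀ b = 0
      · rw [hb]
        simp only [ENNReal.toReal_zero]
        positivity
      · have h1 := ENNReal.toReal_mono (μ₀.apply_ne_top b) (hmin b hb)
        have h2 := (abs_le.1 (hx b)).1
        rw [hβ, div_mul_eq_mul_div, le_div_iff₀ (by linarith)]
        nlinarith
    have h1 := noChange_exists_highScore_le C μ₀ (empirical_ne_top x) hβ0 hμν hlam hγ0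
    have h2 := one_le_mul_lintegral_firstTime _ μ₀ (ENNReal.ofReal_pos.2 hq0).ne' h1
    rw [ENNReal.ofReal_inv_of_pos hq0]
    exact (ENNReal.inv_le_iff_le_mul (fun _ => (ENNReal.ofReal_pos.2 hq0).ne')
      fun h => absurd h ENNReal.ofReal_ne_top).2 h2
  have hPG : ENNReal.ofReal (1 - ε₀) ≤ ∑ x ∈ G, noChange μ₀ {ω | block ω 0 n₀ = x} := by
    have h1 : ∑ x ∈ G, noChange μ₀ {ω | block ω 0 n₀ = x} =
        noChange μ₀ {ω | block ω 0 n₀ ∈ (G : Set (Fin n₀ → X))} := by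
      rw [noChange_block_mem]
      simp_rw [noChange_block_eq]
      simp
    have h2 : {ω : ℕ → X | block ω 0 n₀ ∈ (G : Set (Fin n₀ → X))} =
        {ω | ∃ b, δ < |(empirical (block ω 0 n₀) b).toReal - (μ₀ b).toReal|}ᶜ := by
      ext ω
      simp [hG]
    have h3 : MeasurableSet {ω : ℕ → X | ∃ b,
        δ < |(empirical (block ω 0 n₀) b).toReal - (μ₀ b).toReal|} :=
      measurableSet_block 0 n₀ {x | ∃ b, δ < |(empirical x b).toReal - (μ₀ b).toReal|}
    rw [h1, h2, ← ofReal_measureReal, probReal_compl_eq_one_sub h3]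
    exact ENNReal.ofReal_le_ofReal (by linarith)
  have hmain : ENNReal.ofReal ((1 - ε₀) * q⁻¹) ≤ e := by
    have hdisj : Set.PairwiseDisjoint (G : Set (Fin n₀ → X))
        fun x => {ω : ℕ → X | block ω 0 n₀ = x} := fun x _ y _ hne =>
      Set.disjoint_left.2 fun ω (h : block ω 0 n₀ = x) (h' : block ω 0 n₀ = y) =>
        hne (h.symm.trans h')
    rw [ENNReal.ofReal_mul' (by positivity)]
    calc ENNReal.ofReal (1 - ε₀) * ENNReal.ofReal q⁻¹
        ≤ (∑ x ∈ G, noChange μ₀ {ω | block ω 0 n₀ = x}) * ENNReal.ofReal q⁻¹ := by gcongr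
      _ ≤ ∑ x ∈ G, ∫⁻ ω in {ω | block ω 0 n₀ = x}, (stopTime C lam n₀ γ ω : ℝ≥0∞)
            ∂noChange μ₀ := by
          rw [Finset.sum_mul]
          refine Finset.sum_le_sum fun x hx => ?_
          rw [setLIntegral_stopTime]
          exact mul_le_mul_right (hgood x hx) _
      _ = ∫⁻ ω in ⋃ x ∈ G, {ω | block ω 0 n₀ = x}, (stopTime C lam n₀ γ ω : ℝ≥0∞)
            ∂noChange μ₀ :=
          (lintegral_biUnion_finset hdisj (fun x _ => measurableSet_block 0 n₀ {x}) _).symm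
      _ ≤ e := setLIntegral_le_lintegral _ _
  rw [hbound]
  -- the bound is trivial if `q + ε₀ ≥ 1`, and `(1 - ε₀) / q ≥ 1 / (q + ε₀)` otherwise
  by_cases h1 : 1 ≤ q + ε₀
  · refine le_trans ?_ hone
    rw [ENNReal.ofReal_le_one, div_le_one (by linarith)]
    exact h1
  · refine (ENNReal.ofReal_le_ofReal ?_).trans hmain
    rw [div_le_iff₀ (by linarith), mul_assoc, ← div_eq_inv_mul, ← mul_div_assoc, le_div_iff₀ hq0]
    nlinarith

end FalseAlarmTime

/-! ### The worst-case delay between two mean passage times -/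

section Delay

variable {X : Type*}

theorem firstSamples_le [MeasurableSpace X] (t : ℕ) : firstSamples X t ≤ MeasurableSpace.pi :=
  (measurable_block 0 t).comap_le

/-- The first time at which the whole word observed so far has a high score. -/
noncomputable def firstHighScore (C : PrefixCode X) (ν : X → ℝ≥0∞) (lam γ : ℝ) (ω : ℕ → X) : ℕ∞ :=
  firstTime fun n => 1 ≤ n ∧ block ω 0 n ∈ highScore C ν lam γ n

/-- Starting the test afresh at time `m` cannot make it stop earlier. -/
theorem stopTime_sub_le [DecidableEq X] (C : PrefixCode X) (lam : ℝ) {n₀ m : ℕ} (hm : 1 ≤ m) (γ : ℝ)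
    (ω : ℕ → X) :
    (stopTime C lam n₀ γ ω : ℝ≥0∞) + 1 - m ≤
      (firstHighScore C (empirical (block ω 0 n₀)) lam γ (shift (n₀ + m - 1) ω) : ℝ≥0∞) := by
  obtain ⟨k, rfl⟩ := Nat.exists_eq_add_of_le' hm
  have h : stopTime C lam n₀ γ ω ≤
      k + firstHighScore C (empirical (block ω 0 n₀)) lam γ (shift (n₀ + (k + 1) - 1) ω) := by
    rw [stopTime_eq_firstTime]
    refine firstTime_add_le fun n hn => ⟨k, n, hn.1, rfl, ?_⟩
    have := hn.2
    rw [block_shift] at this ⊢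
    exact this
  have h := ENat.toENNReal_le.2 h
  rw [tsub_le_iff_right]
  push_cast at h ⊢
  calc _ ≤ _ := add_le_add_left h 1
    _ = _ := by ring

theorem changeAt_block_ne_zero [MeasurableSpace X] [MeasurableSingletonClass X]
    (μ₀ μ₁ : PMF X) {n₀ m : ℕ} (hm : 1 ≤ m) {x : Fin n₀ → X} (hx : ∀ i, μ₀ (x i) ≠ 0) :
    changeAt μ₀ μ₁ n₀ m {ω | block ω 0 n₀ = x} ≠ 0 := by
  rw [changeAt, infinitePi_block_eq, Finset.prod_ne_zero_iff]
  intro i _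
  rw [if_pos (by omega), PMF.toMeasure_apply_singleton _ _ (measurableSet_singleton _)]
  exact hx i

variable [Fintype X] [MeasurableSpace X] [MeasurableSingletonClass X]

instance isProbabilityMeasure_changeAt (μ₀ μ₁ : PMF X) (n₀ m : ℕ) :
    IsProbabilityMeasure (changeAt μ₀ μ₁ n₀ m) := by
  unfold changeAt; infer_instance

/-- A conditional expectation given the first `t` samples is the mean over the event that these
samples have the observed values. -/
theorem condLExp_firstSamples_mul (P : Measure (ℕ → X)) [IsProbabilityMeasure P] (t : ℕ)
    (f : (ℕ → X) → ℝ≥0∞) (ω : ℕ → X) :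
    condLExp (firstSamples X t) P f ω * P {ω' | block ω' 0 t = block ω 0 t} =
      ∫⁻ ω' in {ω' | block ω' 0 t = block ω 0 t}, f ω' ∂P := by
  have hconst : ∀ ω' ∈ {ω' | block ω' 0 t = block ω 0 t},
      condLExp (firstSamples X t) P f ω' = condLExp (firstSamples X t) P f ω := by
    intro ω' hω'
    obtain ⟨S, -, hS⟩ := measurable_condLExp (firstSamples X t) P f
      (measurableSet_singleton (condLExp (firstSamples X t) P f ω))
    have h1 : ω ∈ (fun ω => block ω 0 t) ⁻¹' S := by rw [hS]; rfl
    have h2 : ω' ∈ (fun ω => block ω 0 t) ⁻¹' S := by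
      have hω' : block ω' 0 t = block ω 0 t := hω'
      change block ω' 0 t ∈ S
      rw [hω']
      exact h1
    rw [hS] at h2
    exact h2
  have hm : MeasurableSet {ω' : ℕ → X | block ω' 0 t = block ω 0 t} :=
    measurableSet_block 0 t {block ω 0 t}
  have hset := setLIntegral_condLExp (firstSamples_le t) P f
    (s := {ω' | block ω' 0 t = block ω 0 t}) ⟨{block ω 0 t}, measurableSet_singleton _, rfl⟩
  rw [← hset]
  refine Eq.trans ?_ (setLIntegral_congr_fun hm hconst).symm
  rw [setLIntegral_const]

theorem setLIntegral_changeAt_shift (μ₀ μ₁ : PMF X) {n₀ m : ℕ} (y : Fin (n₀ + m - 1) → X)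
    {F : (ℕ → X) → ℝ≥0∞} (hF : Measurable F) :
    ∫⁻ ω in {ω | block ω 0 (n₀ + m - 1) = y}, F (shift (n₀ + m - 1) ω) ∂changeAt μ₀ μ₁ n₀ m =
      changeAt μ₀ μ₁ n₀ m {ω | block ω 0 (n₀ + m - 1) = y} * ∫⁻ ω, F ω ∂noChange μ₁ := by
  have h := setLIntegral_block_shift
    (fun j => (if j < n₀ + m - 1 then μ₀ else μ₁).toMeasure) y hF
  simpa [changeAt, noChange] using h

theorem measurableSet_prefix (A : (l : ℕ) → Set (Fin l → X)) (n : ℕ) :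
    MeasurableSet {ω : ℕ → X | 1 ≤ n ∧ block ω 0 n ∈ A n} :=
  (MeasurableSet.const _).inter (measurableSet_block 0 n _)

variable [DecidableEq X]

/-- The worst-case delay is at most the mean time until the whole word observed since the change
has a high score: whatever preceded the change, the test can only stop earlier. -/
theorem worstDelay_stopTime_le (C : PrefixCode X) (μ₀ μ₁ : PMF X) (lam : ℝ) {n₀ : ℕ} (γ : ℝ)
    (x : Fin n₀ → X) :
    worstDelay μ₀ μ₁ (stopTime C lam n₀ γ) x ≤
      ∫⁻ ω, (firstHighScore C (empirical x) lam γ ω : ℝ≥0∞) ∂noChange μ₁ := by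
  refine iSup₂_le fun m hm => essSup_le_of_ae_le _ ?_
  set P := changeAt μ₀ μ₁ n₀ m with hP
  -- almost surely the observed past has positive probability, so that the conditional mean is
  -- determined by `condLExp_firstSamples_mul`
  have hnull : ∀ᵐ ω ∂P, P {ω' | block ω' 0 (n₀ + m - 1) = block ω 0 (n₀ + m - 1)} ≠ 0 := by
    have : ∀ᵐ ω ∂P, ∀ y : Fin (n₀ + m - 1) → X, P {ω' | block ω' 0 (n₀ + m - 1) = y} = 0 →
        block ω 0 (n₀ + m - 1) ≠ y := by
      refine ae_all_iff.2 fun y => ?_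
      by_cases hy : P {ω' | block ω' 0 (n₀ + m - 1) = y} = 0
      · have : ∀ᵐ ω ∂P, block ω 0 (n₀ + m - 1) ≠ y := by
          rw [ae_iff]
          simpa using hy
        filter_upwards [this] with ω hω _ using hω
      · exact ae_of_all _ fun ω h => absurd h hy
    filter_upwards [this] with ω hω h using hω _ h rfl
  have hx : MeasurableSet {ω : ℕ → X | block ω 0 n₀ = x} := measurableSet_block 0 n₀ {x}
  filter_upwards [cond_absolutelyContinuous.ae_le hnull, ae_cond_mem hx] with ω hω hωx
  have hωx : block ω 0 n₀ = x := hωx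
  have hmul := condLExp_firstSamples_mul P (n₀ + m - 1)
    (fun ω => (stopTime C lam n₀ γ ω : ℝ≥0∞) + 1 - m) ω
  have hle : ∫⁻ ω' in {ω' | block ω' 0 (n₀ + m - 1) = block ω 0 (n₀ + m - 1)},
      ((stopTime C lam n₀ γ ω' : ℝ≥0∞) + 1 - m) ∂P ≤
      P {ω' | block ω' 0 (n₀ + m - 1) = block ω 0 (n₀ + m - 1)} *
        ∫⁻ ω, (firstHighScore C (empirical x) lam γ ω : ℝ≥0∞) ∂noChange μ₁ := by
    rw [← setLIntegral_changeAt_shift μ₀ μ₁ (block ω 0 (n₀ + m - 1))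
      (F := fun ω => (firstHighScore C (empirical x) lam γ ω : ℝ≥0∞))
      (measurable_firstTime fun n => measurableSet_prefix _ n)]
    refine setLIntegral_mono' (measurableSet_block 0 _ {block ω 0 (n₀ + m - 1)}) fun ω' hω' => ?_
    have h1 : block ω' 0 n₀ = x := by
      rw [← hωx]
      exact block_congr hω' (by omega)
    have h2 := stopTime_sub_le C lam (n₀ := n₀) hm γ ω'
    rwa [h1] at h2
  rw [← hmul, mul_comm] at hle
  exact (ENNReal.mul_le_mul_iff_right hω (measure_ne_top P _)).1 hle

/-- The worst-case delay is at least the delay of a change at time `1`, which is the mean time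
until some block of an i.i.d. sequence ends with a high score. -/
theorem le_worstDelay_stopTime (C : PrefixCode X) (μ₀ μ₁ : PMF X) (lam : ℝ) {n₀ : ℕ} (γ : ℝ)
    {x : Fin n₀ → X} (hx : ∀ i, μ₀ (x i) ≠ 0) :
    ∫⁻ ω, (firstTime (Alarm (highScore C (empirical x) lam γ) ω) : ℝ≥0∞) ∂noChange μ₁ ≤
      worstDelay μ₀ μ₁ (stopTime C lam n₀ γ) x := by
  refine le_trans ?_ (le_iSup₂_of_le 1 le_rfl le_rfl)
  set P := changeAt μ₀ μ₁ n₀ 1 with hP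
  have hPx : P {ω | block ω 0 n₀ = x} ≠ 0 := changeAt_block_ne_zero μ₀ μ₁ le_rfl hx
  have hmx : MeasurableSet {ω : ℕ → X | block ω 0 n₀ = x} := measurableSet_block 0 n₀ {x}
  have : IsProbabilityMeasure (P[|{ω | block ω 0 n₀ = x}]) := cond_isProbabilityMeasure hPx
  have hae : condLExp (firstSamples X (n₀ + 1 - 1)) P
      (fun ω => (stopTime C lam n₀ γ ω : ℝ≥0∞) + 1 - (1 : ℕ)) =ᵐ[P[|{ω | block ω 0 n₀ = x}]]
      fun _ => ∫⁻ ω, (firstTime (Alarm (highScore C (empirical x) lam γ) ω) : ℝ≥0∞)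
        ∂noChange μ₁ := by
    filter_upwards [ae_cond_mem hmx] with ω hω
    have hω : block ω 0 n₀ = x := hω
    have hmul := condLExp_firstSamples_mul P (n₀ + 1 - 1)
      (fun ω => (stopTime C lam n₀ γ ω : ℝ≥0∞) + 1 - (1 : ℕ)) ω
    have heq : ∫⁻ ω' in {ω' | block ω' 0 (n₀ + 1 - 1) = block ω 0 (n₀ + 1 - 1)},
        ((stopTime C lam n₀ γ ω' : ℝ≥0∞) + 1 - (1 : ℕ)) ∂P =
        P {ω' | block ω' 0 (n₀ + 1 - 1) = block ω 0 (n₀ + 1 - 1)} *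
          ∫⁻ ω, (firstTime (Alarm (highScore C (empirical x) lam γ) ω) : ℝ≥0∞)
            ∂noChange μ₁ := by
      rw [← setLIntegral_changeAt_shift μ₀ μ₁ (block ω 0 (n₀ + 1 - 1))
        (F := fun ω => (firstTime (Alarm (highScore C (empirical x) lam γ) ω) : ℝ≥0∞))
        (measurable_firstTime fun n => measurableSet_alarm _ n)]
      refine setLIntegral_congr_fun (measurableSet_block 0 _ {block ω 0 (n₀ + 1 - 1)})
        fun ω' hω' => ?_
      have h1 : block ω' 0 n₀ = x := by
        rw [← hω]
        exact block_congr hω' (by omega)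
      simp [stopTime_eq_firstTime, h1]
    rw [← hmul, mul_comm] at heq
    refine (ENNReal.mul_right_inj ?_ (measure_ne_top P _)).1 heq
    rw [← hω] at hPx
    exact hPx
  rw [essSup_congr_ae hae, essSup_const _ (IsProbabilityMeasure.ne_zero _)]

end Delay

/-! ### Upper bounds for the passage time of the whole word -/

section PassageTime

section Universal

variable {X : Type*}

theorem IsStronglyUniversal.eventually_len_add_logb_le {C : PrefixCode X} {S : Set (PMF X)}
    (hC : IsStronglyUniversal C S) {μ : PMF X} (hμ : μ ∈ S) {ε : ℝ} (hε : 0 < ε) :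
    ∀ᶠ n : ℕ in atTop, ∀ w : Fin n → X, wordProb μ w ≠ 0 →
      (C.len w : ℝ) + Real.logb 2 (wordProb μ w).toReal ≤ ε * n := by
  have h := hC.eventually (Iio_mem_nhds (show (0 : EReal) < (ε : EReal) by exact_mod_cast hε))
  filter_upwards [h, eventually_gt_atTop 0] with n hn hn0 w hw
  have hn0' : (0 : EReal) < ((n : ℝ) : EReal) := by exact_mod_cast hn0
  have hn : redundancy C S n / ((n : ℝ) : EReal) < (ε : EReal) := hn
  rw [EReal.div_lt_iff hn0' (EReal.coe_ne_top _)] at hn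
  have h1 : (((C.len w : ℝ) : EReal) + log2 (wordProb μ w)) ≤ redundancy C S n :=
    (le_iSup (fun w : Fin n → X => ((C.len w : ℝ) : EReal) + log2 (wordProb μ w)) w).trans
      (le_iSup₂_of_le μ hμ le_rfl)
  rw [log2_of_ne hw (wordProb_ne_top (fun a => μ.apply_ne_top a) w)] at h1
  have h2 := h1.trans hn.le
  exact_mod_cast h2

/-- The score of a word that is possible under `μ`: the log-likelihood ratio of `μ` to `ν`, less
the redundancy of the code on the word and the drift `l λ`. -/
theorem score_eq_sum_logb (C : PrefixCode X) {μ ν : X → ℝ≥0∞} (hμ : ∀ a, μ a ≠ ⊤)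
    (hν : ∀ a, ν a ≠ ⊤) (hμν : ∀ a, μ a ≠ 0 → ν a ≠ 0) (lam : ℝ) {l : ℕ} {w : Fin l → X}
    (hw : wordProb μ w ≠ 0) :
    score C ν lam w = ((∑ i, Real.logb 2 ((μ (w i)).toReal / (ν (w i)).toReal)
      - ((C.len w : ℝ) + Real.logb 2 (wordProb μ w).toReal) - l * lam : ℝ) : EReal) := by
  have hw' := wordProb_ne_zero_iff.1 hw
  have hνw : wordProb ν w ≠ 0 := wordProb_ne_zero_iff.2 fun i => hμν _ (hw' i)
  rw [score_eq_coe C lam hνw (wordProb_ne_top hν w), EReal.coe_eq_coe_iff, toReal_wordProb,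
    toReal_wordProb, Real.logb_prod, Real.logb_prod]
  · have : ∀ i, Real.logb 2 ((μ (w i)).toReal / (ν (w i)).toReal) =
        Real.logb 2 (μ (w i)).toReal - Real.logb 2 (ν (w i)).toReal := fun i =>
      Real.logb_div (ENNReal.toReal_ne_zero.2 ⟨hw' i, hμ _⟩)
        (ENNReal.toReal_ne_zero.2 ⟨hμν _ (hw' i), hν _⟩)
    rw [Finset.sum_congr rfl fun i _ => this i, Finset.sum_sub_distrib]
    ring
  · exact fun i _ => ENNReal.toReal_ne_zero.2 ⟨hw' i, hμ _⟩
  · exact fun i _ => ENNReal.toReal_ne_zero.2 ⟨hμν _ (hw' i), hν _⟩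

end Universal

variable {X : Type*} [Fintype X] [MeasurableSpace X] [MeasurableSingletonClass X]

theorem noChange_block_mem_mono (μ : PMF X) {l : ℕ} {B B' : Set (Fin l → X)}
    (h : ∀ w ∈ B, wordProb μ w ≠ 0 → w ∈ B') :
    noChange μ {ω | block ω 0 l ∈ B} ≤ noChange μ {ω | block ω 0 l ∈ B'} := by
  classical
  rw [noChange_block_mem, noChange_block_mem, ← Finset.sum_filter_ne_zero]
  refine Finset.sum_le_sum_of_subset fun w hw => ?_
  simp only [Finset.mem_filter, Finset.mem_univ, true_and] at hw ⊢
  exact h w hw.1 hw.2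

theorem lintegral_firstHighScore (C : PrefixCode X) (μ : PMF X) (ν : X → ℝ≥0∞) (lam γ : ℝ) :
    ∫⁻ ω, (firstHighScore C ν lam γ ω : ℝ≥0∞) ∂noChange μ =
      ∑' n : ℕ, noChange μ {ω | ∀ k ≤ n, ¬ (1 ≤ k ∧ block ω 0 k ∈ highScore C ν lam γ k)} :=
  lintegral_firstTime _ fun n => measurableSet_prefix _ n

/-- With universality and finite divergence, the mean of the first passage time is at most
`log γ / d + O(1)` for every `d < D(μ ‖ ν) - λ`: once `n > log γ / d`, a word of length `n` without
high score has an exponentially improbable log-likelihood ratio. -/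
theorem exists_lintegral_firstHighScore_le {C : PrefixCode X} {S : Set (PMF X)}
    (hC : IsStronglyUniversal C S) {μ : PMF X} (hμS : μ ∈ S) {ν : X → ℝ≥0∞}
    (hν : ∀ a, ν a ≠ ⊤) (hμν : ∀ a, μ a ≠ 0 → ν a ≠ 0) {lam d : ℝ} (hd : 0 < d)
    (hdD : d < ∑ a, (μ a).toReal * Real.logb 2 ((μ a).toReal / (ν a).toReal) - lam) :
    ∃ K : ℝ, ∀ γ : ℝ, 1 < γ →
      ∫⁻ ω, (firstHighScore C ν lam γ ω : ℝ≥0∞) ∂noChange μ ≤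
        ENNReal.ofReal (Real.logb 2 γ / d + K) := by
  set f : X → ℝ := fun a => Real.logb 2 ((μ a).toReal / (ν a).toReal) with hf
  set D := ∑ a, (μ a).toReal * f a with hD
  -- half of the gap pays for the redundancy of the code, the other half for the deviation
  set ε := (D - lam - d) / 2 with hε
  have hε0 : 0 < ε := by linarith
  obtain ⟨c, hc, hoeff⟩ := exists_hoeffding μ (fun a => -f a)
  obtain ⟨N, hN⟩ := eventually_atTop.1 (hC.eventually_len_add_logb_le hμS hε0)
  set r := Real.exp (-(c * ε ^ 2)) with hr
  have hr1 : r < 1 := Real.exp_lt_one_iff.2 (by linarith [mul_pos hc (pow_pos hε0 2)])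
  have hr0 : 0 < r := Real.exp_pos _
  refine ⟨N + 2 + (1 - r)⁻¹, fun γ hγ => ?_⟩
  set h := Real.logb 2 γ with hh
  have hh0 : 0 < h := Real.logb_pos one_lt_two hγ
  set n₁ := ⌈h / d⌉₊ + N + 1 with hn₁
  have htail : ∀ n, n₁ ≤ n →
      noChange μ {ω | ∀ k ≤ n, ¬ (1 ≤ k ∧ block ω 0 k ∈ highScore C ν lam γ k)} ≤
        ENNReal.ofReal (r ^ n) := by
    intro n hn
    have hn0 : (0 : ℝ) < n := by exact_mod_cast (show 0 < n by omega)
    have hnd : h ≤ n * d := by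
      rw [← div_le_iff₀ hd]
      exact (Nat.le_ceil _).trans (by exact_mod_cast (show ⌈h / d⌉₊ ≤ n by omega))
    calc noChange μ {ω | ∀ k ≤ n, ¬ (1 ≤ k ∧ block ω 0 k ∈ highScore C ν lam γ k)}
        ≤ noChange μ {ω | block ω 0 n ∈ (highScore C ν lam γ n)ᶜ} :=
          measure_mono fun ω hω hmem => hω n le_rfl ⟨by omega, hmem⟩
      _ ≤ noChange μ {ω | block ω 0 n ∈
            {w | n * (∑ a, (μ a).toReal * -f a) + n * ε ≤ ∑ i, -f (w i)}} := by
          refine noChange_block_mem_mono μ fun w hw hw0 => ?_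
          rw [Set.mem_compl_iff, mem_highScore,
            score_eq_sum_logb C (fun a => μ.apply_ne_top a) hν hμν lam hw0,
            EReal.coe_le_coe_iff, not_le] at hw
          have h1 := hN n (by omega) w hw0
          have h2 : ∑ a, (μ a).toReal * -f a = -D := by simp [hD]
          rw [Set.mem_ofPred_eq, h2, Finset.sum_neg_distrib]
          have h3 : n * d = n * (D - lam) - 2 * (n * ε) := by rw [hε]; ring
          have h4 : ∑ i, f (w i) < h + ε * n + n * lam := by linarith
          nlinarith
      _ ≤ ENNReal.ofReal (Real.exp (-(c * (n * ε) ^ 2 / n))) := hoeff n (n * ε) (by positivity)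
      _ = ENNReal.ofReal (r ^ n) := by
          rw [hr, ← Real.exp_nat_mul]
          congr 2
          field_simp
  rw [lintegral_firstHighScore, ← ENNReal.summable.sum_add_tsum_nat_add' (k := n₁)]
  have hfirst : ∑ n ∈ Finset.range n₁,
      noChange μ {ω | ∀ k ≤ n, ¬ (1 ≤ k ∧ block ω 0 k ∈ highScore C ν lam γ k)} ≤
        ENNReal.ofReal n₁ := by
    refine (Finset.sum_le_card_nsmul _ _ 1 fun n _ => prob_le_one).trans ?_
    simp
  have hrest : ∑' n, noChange μ
      {ω | ∀ k ≤ n + n₁, ¬ (1 ≤ k ∧ block ω 0 k ∈ highScore C ν lam γ k)} ≤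
        ENNReal.ofReal (1 - r)⁻¹ := by
    have hg := hasSum_geometric_of_lt_one hr0.le hr1
    rw [← hg.tsum_eq, ENNReal.ofReal_tsum_of_nonneg (fun n => by positivity) hg.summable]
    refine ENNReal.tsum_le_tsum fun n => (htail _ (by omega)).trans (ENNReal.ofReal_le_ofReal ?_)
    exact pow_le_pow_of_le_one hr0.le hr1.le (by omega)
  refine (add_le_add hfirst hrest).trans ?_
  rw [← ENNReal.ofReal_add (by positivity) (inv_nonneg.2 (by linarith))]
  refine ENNReal.ofReal_le_ofReal ?_
  have := Nat.ceil_lt_add_one (show 0 ≤ h / d by positivity)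
  rw [hn₁]
  push_cast
  linarith

/-- A letter that has probability `0` under `ν` but not under `μ` raises the score to `∞`, and the
mean waiting time for it is finite. -/
theorem lintegral_firstHighScore_le_inv (C : PrefixCode X) (μ : PMF X) {ν : X → ℝ≥0∞} {b : X}
    (hνb : ν b = 0) (lam γ : ℝ) :
    ∫⁻ ω, (firstHighScore C ν lam γ ω : ℝ≥0∞) ∂noChange μ ≤ (μ b)⁻¹ := by
  have hb1 : μ b ≤ 1 := μ.coe_le_one b
  rw [lintegral_firstHighScore]
  calc ∑' n : ℕ, noChange μ {ω | ∀ k ≤ n, ¬ (1 ≤ k ∧ block ω 0 k ∈ highScore C ν lam γ k)}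
      ≤ ∑' n : ℕ, (1 - μ b) ^ n := by
        refine ENNReal.tsum_le_tsum fun n => ?_
        have h1 : (μ.toMeasure {b}ᶜ) = 1 - μ b := by
          rw [prob_compl_eq_one_sub (measurableSet_singleton b),
            PMF.toMeasure_apply_singleton _ _ (measurableSet_singleton _)]
        have h2 : noChange μ (Set.pi (Finset.range n) fun _ => {b}ᶜ) = (1 - μ b) ^ n := by
          rw [noChange, Measure.infinitePi_pi _ fun _ _ => (measurableSet_singleton b).compl]
          simp [h1]
        rw [← h2]
        refine measure_mono fun ω hω i hi hib => ?_
        have hi : i < n := by simpa using hi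
        have hib : ω i = b := hib
        refine hω n le_rfl ⟨by omega, ?_⟩
        have : wordProb ν (block ω 0 n) = 0 :=
          Finset.prod_eq_zero (Finset.mem_univ ⟨i, hi⟩) (by simp [block, hib, hνb])
        rw [mem_highScore, score_eq_top C lam this]
        exact le_top
    _ = (μ b)⁻¹ := by
        rw [ENNReal.tsum_geometric, ENNReal.sub_sub_cancel ENNReal.one_ne_top hb1]

end PassageTime

/-! ### Lower bound for the passage time and asymptotics of the delay -/

section Limit

variable {X : Type*} [Fintype X] [MeasurableSpace X] [MeasurableSingletonClass X]

/-- The mean time to the first alarm exceeds `n` times the probability of no alarm up to time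
`n`, which a union bound over all blocks controls. -/
theorem le_lintegral_firstTime_alarm (A : (l : ℕ) → Set (Fin l → X)) (μ : PMF X) (n : ℕ)
    {p : ℝ} (hp : 0 ≤ p)
    (hA : ∀ l, 1 ≤ l → l ≤ n → noChange μ {ω | block ω 0 l ∈ A l} ≤ ENNReal.ofReal p) :
    ENNReal.ofReal ((n + 1) * (1 - n ^ 2 * p)) ≤
      ∫⁻ ω, (firstTime (Alarm A ω) : ℝ≥0∞) ∂noChange μ := by
  set G := {ω : ℕ → X | ∀ k ≤ n, ¬ Alarm A ω k} with hG
  have hGm : MeasurableSet G := by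
    have : G = ⋂ k, ⋂ _ : k ≤ n, {ω | Alarm A ω k}ᶜ := by
      ext ω
      simp [hG]
    rw [this]
    exact .iInter fun k => .iInter fun _ => (measurableSet_alarm A k).compl
  have hbad : noChange μ Gᶜ ≤ ENNReal.ofReal (n ^ 2 * p) := by
    calc noChange μ Gᶜ
        ≤ noChange μ (⋃ s ∈ Finset.range n, ⋃ l ∈ Finset.Icc 1 n, {ω | block ω s l ∈ A l}) := by
          refine measure_mono fun ω hω => ?_
          obtain ⟨k, hk, s, l, hl, hsl, h⟩ : ∃ k ≤ n, Alarm A ω k := by simpa [hG] using hω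
          refine Set.mem_biUnion (show s ∈ Finset.range n from Finset.mem_range.2 (by omega)) ?_
          exact Set.mem_biUnion (show l ∈ Finset.Icc 1 n from Finset.mem_Icc.2 ⟨hl, by omega⟩) h
      _ ≤ ∑ s ∈ Finset.range n, ∑ l ∈ Finset.Icc 1 n, ENNReal.ofReal p := by
          refine (measure_biUnion_finset_le _ _).trans (Finset.sum_le_sum fun s _ => ?_)
          refine (measure_biUnion_finset_le _ _).trans (Finset.sum_le_sum fun l hl => ?_)
          rw [Finset.mem_Icc] at hl
          rw [noChange_block_mem_shift]
          exact hA l hl.1 hl.2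
      _ = ENNReal.ofReal (n ^ 2 * p) := by
          rw [ENNReal.ofReal_mul (by positivity), ENNReal.ofReal_pow (by positivity)]
          simp [sq, mul_assoc]
  have hgood : ENNReal.ofReal (1 - n ^ 2 * p) ≤ noChange μ G := by
    rw [ENNReal.ofReal_sub _ (by positivity), ENNReal.ofReal_one, tsub_le_iff_right]
    calc (1 : ℝ≥0∞) = noChange μ G + noChange μ Gᶜ := by
          rw [measure_add_measure_compl hGm, measure_univ]
      _ ≤ _ := by gcongr
  rw [lintegral_firstTime _ fun n => measurableSet_alarm A n,
    ENNReal.ofReal_mul (by positivity)]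
  refine le_trans ?_ (ENNReal.sum_le_tsum (Finset.range (n + 1)))
  calc ENNReal.ofReal (n + 1) * ENNReal.ofReal (1 - n ^ 2 * p)
      ≤ ENNReal.ofReal (n + 1) * noChange μ G := by gcongr
    _ = ∑ k ∈ Finset.range (n + 1), noChange μ G := by
        rw [Finset.sum_const, nsmul_eq_mul, Finset.card_range]
        congr 1
        exact_mod_cast ENNReal.ofReal_natCast (n + 1)
    _ ≤ _ := by
        refine Finset.sum_le_sum fun k hk => measure_mono ?_
        intro ω hω j hj
        have : k < n + 1 := by simpa using hk
        exact hω j (by omega)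

/-- The mean of the first time at which some block ends with a high score is at least about
`log γ / (D(μ ‖ ν) - λ)`. A block shorter than `(1 - 2 ε) log γ / (D(μ ‖ ν) - λ)` can have a high
score only if the code is shorter on it than the ideal codelength under `μ` by `ε log γ`, which
Kraft's inequality makes improbable, or if its log-likelihood ratio exceeds its mean by
`ε log γ`, which Hoeffding's inequality makes improbable. -/
theorem exists_le_lintegral_firstTime_highScore (C : PrefixCode X) (μ : PMF X) {ν : X → ℝ≥0∞}
    (hν : ∀ a, ν a ≠ ⊤) (hμν : ∀ a, μ a ≠ 0 → ν a ≠ 0) {lam d ε : ℝ} (hd : 0 < d)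
    (hdD : d = ∑ a, (μ a).toReal * Real.logb 2 ((μ a).toReal / (ν a).toReal) - lam)
    (hε : 0 < ε) (hε' : ε < 1 / 2) :
    ∃ c : ℝ, 0 < c ∧ ∀ γ : ℝ, 1 < γ →
      ENNReal.ofReal ((1 - 2 * ε) * (Real.logb 2 γ / d) *
        (1 - (Real.logb 2 γ / d) ^ 2 * (2 * Real.exp (-(c * Real.logb 2 γ))))) ≤
      ∫⁻ ω, (firstTime (Alarm (highScore C ν lam γ) ω) : ℝ≥0∞) ∂noChange μ := by
  set f : X → ℝ := fun a => Real.logb 2 ((μ a).toReal / (ν a).toReal) with hf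
  set D := ∑ a, (μ a).toReal * f a with hD
  obtain ⟨c, hc, hoeff⟩ := exists_hoeffding μ f
  have hlog2 : 0 < Real.log 2 := Real.log_pos one_lt_two
  set c' := min (ε * Real.log 2) (c * ε ^ 2 * d) with hc'
  have hc'0 : 0 < c' := lt_min (by positivity) (by positivity)
  refine ⟨c', hc'0, fun γ hγ => ?_⟩
  set h := Real.logb 2 γ with hh
  have hh0 : 0 < h := Real.logb_pos one_lt_two hγ
  set n := ⌊(1 - 2 * ε) * (h / d)⌋₊ with hn
  have hn1 : (n : ℝ) ≤ (1 - 2 * ε) * (h / d) :=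
    Nat.floor_le (mul_nonneg (by linarith) (by positivity))
  have hn2 : (1 - 2 * ε) * (h / d) ≤ n + 1 := (Nat.lt_floor_add_one _).le
  have hhd : 0 < h / d := by positivity
  have hblock : ∀ l, 1 ≤ l → l ≤ n → noChange μ {ω | block ω 0 l ∈ highScore C ν lam γ l} ≤
      ENNReal.ofReal (2 * Real.exp (-(c' * h))) := by
    intro l hl hln
    have hl0 : (0 : ℝ) < l := by exact_mod_cast hl
    have hld : l * d ≤ (1 - 2 * ε) * h := by
      have : (l : ℝ) ≤ (1 - 2 * ε) * (h / d) := le_trans (by exact_mod_cast hln) hn1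
      calc l * d ≤ (1 - 2 * ε) * (h / d) * d := by gcongr
        _ = (1 - 2 * ε) * h := by field_simp
    have hcode : noChange μ {ω | block ω 0 l ∈
        {w | (C.len w : ℝ) + Real.logb 2 (wordProb μ w).toReal ≤ -(ε * h)}} ≤
          ENNReal.ofReal (Real.exp (-(c' * h))) := by
      refine (noChange_block_mem_le_of_kraft C μ (c := (2 : ℝ) ^ (-(ε * h))) (by positivity)
        fun w hw hw0 => ?_).trans (ENNReal.ofReal_le_ofReal ?_)
      · rw [Set.mem_ofPred_eq] at hw
        have hpos := ENNReal.toReal_pos hw0 (wordProb_ne_top (fun a => μ.apply_ne_top a) w)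
        rw [one_div, inv_pow, ← Real.rpow_natCast, ← Real.rpow_neg two_pos.le,
          ← Real.rpow_add two_pos, ← Real.logb_le_iff_le_rpow one_lt_two hpos]
        linarith
      · rw [Real.rpow_def_of_pos two_pos]
        refine Real.exp_le_exp.2 ?_
        have := mul_le_mul_of_nonneg_right (min_le_left (ε * Real.log 2) (c * ε ^ 2 * d)) hh0.le
        rw [← hc'] at this
        linarith
    have hdev : noChange μ {ω | block ω 0 l ∈ {w | l * D + ε * h ≤ ∑ i, f (w i)}} ≤
          ENNReal.ofReal (Real.exp (-(c' * h))) := by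
      refine (hoeff l (ε * h) (by positivity)).trans
        (ENNReal.ofReal_le_ofReal (Real.exp_le_exp.2 (neg_le_neg ?_)))
      rw [le_div_iff₀ hl0]
      have h1 : c' ≤ c * ε ^ 2 * d := min_le_right _ _
      have h2 : l * d ≤ h := hld.trans (by nlinarith)
      calc c' * h * l ≤ c * ε ^ 2 * d * h * l := by gcongr
        _ = c * ε ^ 2 * h * (l * d) := by ring
        _ ≤ c * ε ^ 2 * h * h := by gcongr
        _ = c * (ε * h) ^ 2 := by ring
    have hsub := noChange_block_mem_mono μ (l := l) (B := highScore C ν lam γ l)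
      (B' := {w | (C.len w : ℝ) + Real.logb 2 (wordProb μ w).toReal ≤ -(ε * h)} ∪
        {w | l * D + ε * h ≤ ∑ i, f (w i)}) (by
      intro w hw hw0
      rw [mem_highScore, score_eq_sum_logb C (fun a => μ.apply_ne_top a) hν hμν lam hw0,
        EReal.coe_le_coe_iff] at hw
      rw [Set.mem_union, Set.mem_ofPred_eq, Set.mem_ofPred_eq]
      by_contra! hcon
      have h3 : l * d = l * D - l * lam := by rw [hdD]; ring
      linarith [hcon.1, hcon.2])
    refine hsub.trans ?_
    rw [two_mul, ENNReal.ofReal_add (Real.exp_pos _).le (Real.exp_pos _).le]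
    exact (measure_union_le _ _).trans (add_le_add hcode hdev)
  refine le_trans ?_ (le_lintegral_firstTime_alarm (highScore C ν lam γ) μ n
    (by positivity) hblock)
  set p := 2 * Real.exp (-(c' * h)) with hp
  have hp0 : 0 < p := by positivity
  have hnh : (n : ℝ) ≤ h / d := hn1.trans (by nlinarith)
  by_cases hneg : 1 - (h / d) ^ 2 * p ≤ 0
  · rw [ENNReal.ofReal_of_nonpos]
    · exact zero_le
    · exact mul_nonpos_of_nonneg_of_nonpos (mul_nonneg (by linarith) hhd.le) hneg
  · refine ENNReal.ofReal_le_ofReal (mul_le_mul hn2 ?_ (le_of_not_ge hneg) (by positivity))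
    gcongr

/-- Asymptotic equivalence in `[0, ∞]`, from bounds that are tight up to factors near `1`. -/
theorem tendsto_div_ofReal_one {α : Type*} {l : Filter α} {W : α → ℝ≥0∞} {u : α → ℝ}
    (hu : ∀ᶠ x in l, 0 < u x)
    (hlow : ∀ ε > 0, ∀ᶠ x in l, ENNReal.ofReal ((1 - ε) * u x) ≤ W x)
    (hup : ∀ ε > 0, ∀ᶠ x in l, W x ≤ ENNReal.ofReal ((1 + ε) * u x)) :
    Tendsto (fun x => W x / ENNReal.ofReal (u x)) l (𝓝 1) := by
  have hlim1 : Tendsto (fun ε : ℝ => ENNReal.ofReal (1 - ε)) (𝓝[>] 0) (𝓝 1) := by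
    have : Tendsto (fun ε : ℝ => ENNReal.ofReal (1 - ε)) (𝓝 0) (𝓝 (ENNReal.ofReal (1 - 0))) :=
      (ENNReal.continuous_ofReal.comp (by fun_prop : Continuous fun ε : ℝ => 1 - ε)).tendsto 0
    simpa using this.mono_left nhdsWithin_le_nhds
  have hlim2 : Tendsto (fun ε : ℝ => ENNReal.ofReal (1 + ε)) (𝓝[>] 0) (𝓝 1) := by
    have : Tendsto (fun ε : ℝ => ENNReal.ofReal (1 + ε)) (𝓝 0) (𝓝 (ENNReal.ofReal (1 + 0))) :=
      (ENNReal.continuous_ofReal.comp (by fun_prop : Continuous fun ε : ℝ => 1 + ε)).tendsto 0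
    simpa using this.mono_left nhdsWithin_le_nhds
  rw [tendsto_order]
  constructor
  · intro a ha
    obtain ⟨ε, hεa, hε⟩ := ((hlim1.eventually_const_lt ha).and self_mem_nhdsWithin).exists
    filter_upwards [hu, hlow ε hε] with x hx hlx
    refine hεa.trans_le ?_
    rw [ENNReal.le_div_iff_mul_le (.inl (ENNReal.ofReal_pos.2 hx).ne')
      (.inl ENNReal.ofReal_ne_top), ← ENNReal.ofReal_mul' hx.le]
    exact hlx
  · intro a ha
    obtain ⟨ε, hεa, hε⟩ := ((hlim2.eventually_lt_const ha).and self_mem_nhdsWithin).exists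
    filter_upwards [hu, hup ε hε] with x hx hux
    refine lt_of_le_of_lt ?_ hεa
    rw [ENNReal.div_le_iff_le_mul (.inl (ENNReal.ofReal_pos.2 hx).ne')
      (.inl ENNReal.ofReal_ne_top), ← ENNReal.ofReal_mul' hx.le]
    exact hux

theorem tendsto_sq_mul_exp_neg {c d : ℝ} (hc : 0 < c) :
    Tendsto (fun h : ℝ => (h / d) ^ 2 * (2 * Real.exp (-(c * h)))) atTop (𝓝 0) := by
  have h1 := (Real.tendsto_pow_mul_exp_neg_atTop_nhds_zero 2).comp
    (tendsto_id.const_mul_atTop hc)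
  have h2 := h1.const_mul (2 / (c * d) ^ 2)
  rw [mul_zero] at h2
  refine h2.congr fun h => ?_
  simp only [Function.comp, id]
  rcases eq_or_ne d 0 with rfl | hd
  · simp
  · field_simp

theorem tendsto_logb_two_atTop : Tendsto (Real.logb 2) atTop atTop :=
  Real.tendsto_logb_atTop one_lt_two

variable [DecidableEq X]

/-- For finite divergence the worst-case delay is asymptotic to `log γ / (D(μ₁ ‖ μ̂₀) - λ)`. -/
theorem tendsto_worstDelay_div {C : PrefixCode X} {S : Set (PMF X)}
    (hC : IsStronglyUniversal C S) (μ₀ : PMF X) {μ₁ : PMF X} (hμS : μ₁ ∈ S) {n₀ : ℕ}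
    {x : Fin n₀ → X} (hx : ∀ i, μ₀ (x i) ≠ 0) (hμν : ∀ a, μ₁ a ≠ 0 → empirical x a ≠ 0)
    {lam d : ℝ} (hd : 0 < d)
    (hdD : d = ∑ a, (μ₁ a).toReal * Real.logb 2 ((μ₁ a).toReal / (empirical x a).toReal) - lam) :
    Tendsto (fun γ : ℝ => worstDelay μ₀ μ₁ (stopTime C lam n₀ γ) x /
      ENNReal.ofReal (|Real.logb 2 γ| / d)) atTop (𝓝 1) := by
  have hgt : ∀ᶠ γ : ℝ in atTop, 1 < γ := eventually_gt_atTop 1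
  refine tendsto_div_ofReal_one ?_ ?_ ?_
  · filter_upwards [hgt] with γ hγ
    have := Real.logb_pos one_lt_two hγ
    positivity
  · intro ε₀ hε₀
    set ε := min (ε₀ / 3) (1 / 4) with hε
    have hε0 : 0 < ε := lt_min (by linarith) (by norm_num)
    have hε1 : ε ≤ 1 / 4 := min_le_right _ _
    have hε2 : ε ≤ ε₀ / 3 := min_le_left _ _
    obtain ⟨c, hc, hlow⟩ := exists_le_lintegral_firstTime_highScore C μ₁ (empirical_ne_top x) hμν
      hd hdD hε0 (by linarith)
    have hlim := ((tendsto_sq_mul_exp_neg (d := d) hc).comp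
      tendsto_logb_two_atTop).eventually_lt_const hε0
    filter_upwards [hgt, hlim] with γ hγ hsmall
    have hlog := Real.logb_pos one_lt_two hγ
    rw [abs_of_pos hlog]
    refine le_trans (ENNReal.ofReal_le_ofReal ?_)
      ((hlow γ hγ).trans (le_worstDelay_stopTime C μ₀ μ₁ lam γ hx))
    simp only [Function.comp] at hsmall
    set ρ := (Real.logb 2 γ / d) ^ 2 * (2 * Real.exp (-(c * Real.logb 2 γ))) with hρ
    have hpos : 0 < Real.logb 2 γ / d := by positivity
    rw [mul_right_comm]
    refine mul_le_mul_of_nonneg_right ?_ hpos.le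
    nlinarith
  · intro ε hε
    -- half of `ε` goes into the slope `1 / d'`, the other half absorbs the constant `K`
    set d' := d / (1 + ε / 2) with hd'
    have hd'0 : 0 < d' := by positivity
    have hd'd : d' < d := div_lt_self hd (by linarith)
    obtain ⟨K, hK⟩ := exists_lintegral_firstHighScore_le hC hμS (empirical_ne_top x) hμν hd'0
      (hd'd.trans_eq hdD)
    filter_upwards [hgt, tendsto_logb_two_atTop.eventually_ge_atTop (K * (2 * d / ε))]
      with γ hγ hbig
    have hlog := Real.logb_pos one_lt_two hγ
    rw [abs_of_pos hlog]
    refine (worstDelay_stopTime_le C μ₀ μ₁ lam γ x).trans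
      ((hK γ hγ).trans (ENNReal.ofReal_le_ofReal ?_))
    have h1 : Real.logb 2 γ / d' = (1 + ε / 2) * (Real.logb 2 γ / d) := by
      rw [hd']
      field_simp
    have h2 : K ≤ ε / 2 * (Real.logb 2 γ / d) := by
      calc K = K * (2 * d / ε) * (ε / (2 * d)) := by field_simp
        _ ≤ Real.logb 2 γ * (ε / (2 * d)) := by gcongr
        _ = ε / 2 * (Real.logb 2 γ / d) := by field_simp
    rw [h1]
    linarith

/-- For infinite divergence the worst-case delay is bounded in `γ`: the test stops at
the latest when a letter that does not occur in `x` is observed. -/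
theorem tendsto_worstDelay_div_zero (C : PrefixCode X) (μ₀ μ₁ : PMF X) {n₀ : ℕ}
    {x : Fin n₀ → X} {b : X} (hμb : μ₁ b ≠ 0) (hxb : empirical x b = 0) (lam : ℝ) :
    Tendsto (fun γ : ℝ => worstDelay μ₀ μ₁ (stopTime C lam n₀ γ) x /
      ENNReal.ofReal |Real.logb 2 γ|) atTop (𝓝 0) := by
  have h1 : Tendsto (fun γ : ℝ => ENNReal.ofReal |Real.logb 2 γ|) atTop (𝓝 ⊤) :=
    ENNReal.tendsto_ofReal_atTop.comp (tendsto_abs_atTop_atTop.comp tendsto_logb_two_atTop)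
  have h2 : Tendsto (fun γ : ℝ => (μ₁ b)⁻¹ / ENNReal.ofReal |Real.logb 2 γ|) atTop (𝓝 0) := by
    simpa using ENNReal.Tendsto.const_div h1 (.inr (ENNReal.inv_ne_top.2 hμb))
  refine tendsto_of_tendsto_of_tendsto_of_le_of_le tendsto_const_nhds h2 (fun _ => zero_le)
    fun γ => ?_
  exact ENNReal.div_le_div_right ((worstDelay_stopTime_le C μ₀ μ₁ lam γ x).trans
    (lintegral_firstHighScore_le_inv C μ₁ hxb lam γ)) _

end Limit

end SeqChange

theorem mainTheorem2 {X : Type*} [Fintype X] [DecidableEq X] [MeasurableSpace X]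
    [MeasurableSingletonClass X] (C : SeqChange.PrefixCode X) (μ₀ : PMF X) (lam : ℝ)
    (n₀ : ℕ) (hn₀ : 0 < n₀) :
    (∀ (a : X) (δ β ε₀ γ : ℝ),
      μ₀ a ≠ 0 → (∀ b, μ₀ b ≠ 0 → μ₀ a ≤ μ₀ b) →
      0 < δ → δ < (μ₀ a).toReal → β = (μ₀ a).toReal / ((μ₀ a).toReal - δ) →
      (SeqChange.noChange μ₀).real
        {ω | ∃ b, δ < |(SeqChange.empirical (SeqChange.block ω 0 n₀) b).toReal
          - (μ₀ b).toReal|} ≤ ε₀ →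
      Real.logb 2 β < lam → 1 < γ →
      ENNReal.ofReal (γ / (1 / ((2 : ℝ) ^ (lam - Real.logb 2 β) - 1) + ε₀ * γ))
        ≤ ∫⁻ ω, (SeqChange.stopTime C lam n₀ γ ω : ℝ≥0∞) ∂(SeqChange.noChange μ₀)) ∧
    (∀ (S : Set (PMF X)) (μ₁ : PMF X) (x : Fin n₀ → X),
      SeqChange.IsStronglyUniversal C S → μ₁ ∈ S → (∀ i, μ₀ (x i) ≠ 0) →
      (lam : EReal) < SeqChange.klBits μ₁ (SeqChange.empirical x) →
      (SeqChange.klBits μ₁ (SeqChange.empirical x) ≠ ⊤ →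
        Tendsto (fun γ : ℝ =>
            SeqChange.worstDelay μ₀ μ₁ (SeqChange.stopTime C lam n₀ γ) x /
              ENNReal.ofReal (|Real.logb 2 γ| /
                ((SeqChange.klBits μ₁ (SeqChange.empirical x)).toReal - lam)))
          atTop (𝓝 1)) ∧
      (SeqChange.klBits μ₁ (SeqChange.empirical x) = ⊤ →
        Tendsto (fun γ : ℝ =>
            SeqChange.worstDelay μ₀ μ₁ (SeqChange.stopTime C lam n₀ γ) x /
              ENNReal.ofReal |Real.logb 2 γ|)
          atTop (𝓝 0))) := by
  refine ⟨fun a δ β ε₀ γ _ hmin hδ hδa hβ hε hlam hγ =>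
    SeqChange.le_lintegral_stopTime C μ₀ lam n₀ a δ β ε₀ γ hmin hδa hδ hβ hε hlam hγ,
    fun S μ₁ x hC hμS hx hlam => ?_⟩
  have hν := SeqChange.empirical_ne_top x
  have hμ : ∀ a, μ₁ a ≠ ⊤ := fun a => μ₁.apply_ne_top a
  constructor
  · intro hfin
    have hμν : ∀ a, μ₁ a ≠ 0 → SeqChange.empirical x a ≠ 0 := fun a ha h0 =>
      hfin (SeqChange.klBits_eq_top hμ hν ha h0)
    rw [SeqChange.klBits_eq_coe hμ hν hμν] at hlam ⊢
    rw [EReal.coe_lt_coe_iff] at hlam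
    rw [EReal.toReal_coe]
    exact SeqChange.tendsto_worstDelay_div hC μ₀ hμS hx hμν (sub_pos.2 hlam) rfl
  · intro htop
    obtain ⟨b, hb, hxb⟩ : ∃ b, μ₁ b ≠ 0 ∧ SeqChange.empirical x b = 0 := by
      by_contra! hμν
      rw [SeqChange.klBits_eq_coe hμ hν hμν] at htop
      exact EReal.coe_ne_top _ htop
    exact SeqChange.tendsto_worstDelay_div_zero C μ₀ μ₁ hb hxb lam
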